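/- Let $(M,g)$ be a connected smooth Riemannian manifold (without boundary) of dimension $n>2$, with Levi-Civita connection $\nabla$, Ricci tensor $S$, scalar curvature $\mathrm{scal}$, and Ricci operator $Q$ given by $g(QX,Y)=S(X,Y)$. Let $\xi$ be a smooth vector field, $\eta=g(\xi,\cdot)$ its $g$-dual $1$-form, and $\lambda,\mu\in\mathbb{R}$, and suppose that $(g,\xi,\lambda,\mu)$ is an $\eta$-Ricci soliton: $$L_\xi g+2S+2\lambda g+2\mu\,\eta\otimes\eta=0 .$$ For a $1$-form $\gamma$ let $\gamma^\sharp$ be the dual vector field, $S_\sharp(\gamma)=S(\gamma^\sharp,\cdot)$, and let $\Delta=-(d\delta+\delta d)$ be the Laplace-Hodge operator. The form $\gamma$ is called *harmonic* if $\Delta\gamma=0$, *Schrödinger-Ricci harmonic* if $(\Delta+S_\sharp)(\gamma)=0$, and a *solution of the Schrödinger-Ricci equation* if $(\Delta+S_\sharp)(\gamma)+d(\mathrm{div}(\gamma^\sharp))=0$. Write $|\xi|^2=g(\xi,\xi)$ and $i_{Q\xi}g=g(Q\xi,\cdot)$; $\xi\in\ker Q$ means that $Q\xi=0$ everywhere.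 1. Suppose that $\eta$ is a solution of the Schrödinger-Ricci equation. Then (a) $\eta$ is Schrödinger-Ricci harmonic if and only if $\mathrm{scal}+\mu|\xi|^2$ is constant; (b) $\eta$ is harmonic if and only if $i_{Q\xi}g=d(\mathrm{scal}+\mu|\xi|^2)$; moreover, if $M$ is compact or $\mathrm{div}(\xi)=0$, then $\eta$ harmonic implies $\xi\in\ker Q$. 2. Suppose that $\eta$ is Schrödinger-Ricci harmonic. Then (a) $\eta$ is a solution of the Schrödinger-Ricci equation if and only if $\mathrm{scal}+\mu|\xi|^2$ is constant; (b) $\eta$ is harmonic if and only if $\xi\in\ker Q$. 3. Suppose that $\eta$ is harmonic. Then (a) if $M$ is compact or $\mathrm{div}(\xi)=0$, then $\eta$ is a solution of the Schrödinger-Ricci equation if and only if $\xi\in\ker Q$; (b) $\eta$ is Schrödinger-Ricci harmonic if and only if $\xi\in\ker Q$. -/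

import Mathlib

open scoped Manifold ContDiff Bundle

noncomputable section

namespace EtaRicci

/-- Vector fields on `M` (smoothness is a separate hypothesis). -/
abbrev VField (n : ℕ) (M : Type*) [TopologicalSpace M]
    [ChartedSpace (EuclideanSpace ℝ (Fin n)) M] : Type _ :=
  ∀ x : M, TangentSpace (𝓡 n) x

/-- Differential `1`-forms on `M`. -/
abbrev OneForm (n : ℕ) (M : Type*) [TopologicalSpace M]
    [ChartedSpace (EuclideanSpace ℝ (Fin n)) M] : Type _ :=
  ∀ x : M, TangentSpace (𝓡 n) x →L[ℝ] ℝ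

/-- Fields of functions of two tangent vectors; used for `(0,2)`-tensor fields. -/
abbrev TwoTensor (n : ℕ) (M : Type*) [TopologicalSpace M]
    [ChartedSpace (EuclideanSpace ℝ (Fin n)) M] : Type _ :=
  ∀ x : M, TangentSpace (𝓡 n) x → TangentSpace (𝓡 n) x → ℝ

section Smooth

variable {n : ℕ} {M : Type*} [TopologicalSpace M] [ChartedSpace (EuclideanSpace ℝ (Fin n)) M]

/-- The vector field is smooth, as a section of the tangent bundle. -/
def IsSmooth [IsManifold (𝓡 n) ∞ M] (X : VField n M) : Prop :=
  ContMDiff (𝓡 n) (𝓡 n).tangent ∞ (fun x => (⟨x, X x⟩ : TangentBundle (𝓡 n) M))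

/-- The differential `df` of a real function. -/
def diff (f : M → ℝ) : OneForm n M := fun x => mvfderiv (𝓡 n) f x

/-- A vector field that is smooth near `x` and has the value `v` at `x`. The tensorial expressions
below do not depend on this choice. -/
def ext [IsManifold (𝓡 n) ∞ M] {x : M} (v : TangentSpace (𝓡 n) x) : VField n M :=
  FiberBundle.extend (EuclideanSpace ℝ (Fin n)) v

/-- The Lie bracket `[X, Y]`. -/
def bracket (X Y : VField n M) : VField n M := VectorField.mlieBracket (𝓡 n) X Y

/-- The exterior derivative of a `1`-form,
`dγ(X, Y) = X(γ(Y)) - Y(γ(X)) - γ([X, Y])`. -/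
def extDeriv [IsManifold (𝓡 n) ∞ M] (γ : OneForm n M) : TwoTensor n M := fun x v w =>
  diff (fun y => γ y (ext w y)) x v - diff (fun y => γ y (ext v y)) x w
    - γ x (bracket (ext v) (ext w) x)

end Smooth

section Metric

variable {n : ℕ} {M : Type*} [TopologicalSpace M] [ChartedSpace (EuclideanSpace ℝ (Fin n)) M]
  [IsManifold (𝓡 n) ∞ M] [Bundle.RiemannianBundle (fun x : M => TangentSpace (𝓡 n) x)]

instance instFiniteDimensionalTangent (x : M) : FiniteDimensional ℝ (TangentSpace (𝓡 n) x) :=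
  inferInstanceAs (FiniteDimensional ℝ (EuclideanSpace ℝ (Fin n)))

/-- The metric `g`. -/
def g (x : M) (v w : TangentSpace (𝓡 n) x) : ℝ := inner ℝ v w

/-- An orthonormal basis of the tangent space at `x`. -/
def onb (x : M) : OrthonormalBasis (Fin (Module.finrank ℝ (TangentSpace (𝓡 n) x))) ℝ
    (TangentSpace (𝓡 n) x) :=
  stdOrthonormalBasis ℝ (TangentSpace (𝓡 n) x)

/-- The trace `∑ᵢ b(eᵢ, eᵢ)` over an orthonormal basis of the tangent space at `x`. -/
def tr (x : M) (b : TangentSpace (𝓡 n) x → TangentSpace (𝓡 n) x → ℝ) : ℝ :=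
  ∑ i, b (onb x i) (onb x i)

/-- The vector dual to a linear functional `a`, `∑ᵢ a(eᵢ) eᵢ`. -/
def dualVec (x : M) (a : TangentSpace (𝓡 n) x → ℝ) : TangentSpace (𝓡 n) x :=
  ∑ i, a (onb x i) • onb x i

/-- The musical isomorphism `X ↦ X♭ = g(X, ·)`. -/
def flat (X : VField n M) : OneForm n M := fun x => innerSL ℝ (X x)

/-- The musical isomorphism `γ ↦ γ♯`, inverse to `flat`. -/
def sharp (γ : OneForm n M) : VField n M := fun x => dualVec x (γ x)

/-- The value of `g(∇_X Y, Z)` given by the Koszul formula. -/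
def koszul (X Y Z : VField n M) (x : M) : ℝ :=
  (diff (fun y => g y (Y y) (Z y)) x (X x) + diff (fun y => g y (X y) (Z y)) x (Y x)
    - diff (fun y => g y (X y) (Y y)) x (Z x)
    + g x (bracket X Y x) (Z x) - g x (bracket X Z x) (Y x) - g x (bracket Y Z x) (X x)) / 2

/-- The Levi-Civita connection `∇_X Y`. -/
def nabla (X Y : VField n M) : VField n M := fun x =>
  dualVec x (fun w => koszul X Y (ext w) x)

/-- The curvature `R(X, Y) Z = ∇_X ∇_Y Z - ∇_Y ∇_X Z - ∇_[X,Y] Z`. -/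
def curv (X Y Z : VField n M) : VField n M :=
  nabla X (nabla Y Z) - nabla Y (nabla X Z) - nabla (bracket X Y) Z

/-- The Ricci tensor `S(v, w) = trace (u ↦ R(u, v) w)`. -/
def ricci : TwoTensor n M := fun x v w => tr x (fun u u' => g x (curv (ext u) (ext v) (ext w) x) u')

variable (n) in
/-- The scalar curvature. -/
def scal (x : M) : ℝ := tr x (ricci (n := n) x)

/-- The Ricci operator `Q`, `g(Q v, w) = S(v, w)`. -/
def ricciOp (x : M) (v : TangentSpace (𝓡 n) x) : TangentSpace (𝓡 n) x := dualVec x (ricci x v)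

/-- `S_♯(γ) = S(γ♯, ·)`. -/
def ricciSharp (γ : OneForm n M) (x : M) (w : TangentSpace (𝓡 n) x) : ℝ := ricci x (sharp γ x) w

/-- The divergence of a vector field, `trace (v ↦ ∇_v X)`. -/
def div (X : VField n M) (x : M) : ℝ := tr x (fun v w => g x (nabla (ext v) X x) w)

/-- The Lie derivative of the metric,
`(L_X g)(Y, Z) = X(g(Y, Z)) - g([X, Y], Z) - g(Y, [X, Z])`. -/
def lieMetric (X : VField n M) : TwoTensor n M := fun x v w =>
  diff (fun y => g y (ext v y) (ext w y)) x (X x)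
    - g x (bracket X (ext v) x) w - g x v (bracket X (ext w) x)

/-- `(∇_v γ)(w)` for a `1`-form `γ`. -/
def covOne (γ : OneForm n M) (x : M) (v w : TangentSpace (𝓡 n) x) : ℝ :=
  diff (fun y => γ y (ext w y)) x v - γ x (nabla (ext v) (ext w) x)

/-- `(∇_u α)(v, w)` for a `(0,2)`-tensor field `α`. -/
def covTwo (α : TwoTensor n M) (x : M) (u v w : TangentSpace (𝓡 n) x) : ℝ :=
  diff (fun y => α y (ext v y) (ext w y)) x u
    - α x (nabla (ext u) (ext v) x) w - α x v (nabla (ext u) (ext w) x)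

/-- The codifferential of a `1`-form, `δγ = -∑ᵢ (∇_{eᵢ} γ)(eᵢ)`. -/
def codiffOne (γ : OneForm n M) (x : M) : ℝ := -tr x (covOne γ x)

/-- The codifferential of a `2`-form, `(δα)(w) = -∑ᵢ (∇_{eᵢ} α)(eᵢ, w)`. -/
def codiffTwo (α : TwoTensor n M) (x : M) (w : TangentSpace (𝓡 n) x) : ℝ :=
  -tr x (fun u v => covTwo α x u v w)

/-- The Laplace-Hodge operator on `1`-forms, with the sign for which `Δ(df) = d(div(grad f))`:
`Δ = -(d δ + δ d)`. -/
def hodgeLaplacian (γ : OneForm n M) (x : M) (w : TangentSpace (𝓡 n) x) : ℝ :=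
  -(diff (codiffOne γ) x w + codiffTwo (extDeriv γ) x w)

/-- `γ` is harmonic: `Δ γ = 0`. -/
def IsHarmonic (γ : OneForm n M) : Prop := ∀ x w, hodgeLaplacian γ x w = 0

/-- `γ` is Schrödinger-Ricci harmonic: `(Δ + S_♯) γ = 0`. -/
def IsSRHarmonic (γ : OneForm n M) : Prop := ∀ x w, hodgeLaplacian γ x w + ricciSharp γ x w = 0

/-- `γ` solves the Schrödinger-Ricci equation `(Δ + S_♯) γ + d(div(γ♯)) = 0`. -/
def IsSRSolution (γ : OneForm n M) : Prop :=
  ∀ x w, hodgeLaplacian γ x w + ricciSharp γ x w + diff (div (sharp γ)) x w = 0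

/-- The `η`-Ricci soliton equation `L_ξ g + 2 S + 2 lam g + 2 mu η ⊗ η = 0`. -/
def IsEtaRicciSoliton (ξ : VField n M) (η : OneForm n M) (lam mu : ℝ) : Prop :=
  ∀ (x : M) (v w : TangentSpace (𝓡 n) x),
    lieMetric ξ x v w + 2 * ricci x v w + 2 * lam * g x v w + 2 * mu * (η x v * η x w) = 0

end Metric

end EtaRicci

end

/-! Tracing the soliton equation gives div ξ = -(scal + μ|ξ|²) - λn, so d(scal + μ|ξ|²) = -d(div ξ).
Every condition in the theorem thus becomes the pointwise vanishing of a combination of three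
1-forms: Δη, S(ξ, ·) and d(div ξ). Almost all claims are then linear algebra, with connectedness
turning d(div ξ) = 0 into constancy.

The analytic point is that on a compact M a harmonic η has d(div ξ) = 0. Integration is avoided.
With f = δη = -div ξ, Δη = 0 reads df = -δ(dη), and δδ = 0 makes f a harmonic function. In a chart f
solves an elliptic equation without zeroth-order term. Hopf's strong maximum principle
(`eventually_eq_of_diffOp_eq_zero`) makes the set where f attains its maximum open; it is also
closed and nonempty, hence all of M (`exists_div_eq_of_isHarmonic`).

To reach that equation, the metric is written in a chart as a field of operators G. The operators of
the statement are computed in these terms, and δδ = 0 becomes the vanishing of the double divergence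
of an antisymmetric bivector (`sum_divergence_antisymm`). There the Christoffel symbols enter only
through their trace, the closed form `theta`. -/

namespace EtaRicci

/-! ### Hopf's strong maximum principle in Euclidean space. -/

section MaximumPrinciple

open Topology Filter

variable {E : Type*} [NormedAddCommGroup E] [InnerProductSpace ℝ E]

/-- The second directional derivative `∂_u ∂_v f`. -/
noncomputable def secondDeriv (f : E → ℝ) (z u v : E) : ℝ := fderiv ℝ (fun y => fderiv ℝ f y v) z u

/-- Restrict to the line through z along c. A positive second derivative would make 0 a local
minimum as well as a local maximum, so the restriction would be locally constant, with zero second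
derivative. -/
lemma secondDeriv_nonpos_of_isLocalMax {f : E → ℝ} {z : E} (hf : ContDiffAt ℝ 2 f z)
    (hmax : IsLocalMax f z) (c : E) : secondDeriv f z c c ≤ 0 := by
  by_contra! hpos
  set φ : ℝ → ℝ := fun t => f (z + t • c) with hφ
  have hline : ∀ t : ℝ, HasDerivAt (fun t : ℝ => z + t • c) c t := fun t => by
    simpa using ((hasDerivAt_id t).smul_const c).const_add z
  have hcont : Tendsto (fun t : ℝ => z + t • c) (𝓝 0) (𝓝 z) := by
    simpa [ContinuousAt] using (hline 0).continuousAt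
  have hev : ∀ᶠ y in 𝓝 z, ContDiffAt ℝ 2 f y := hf.eventually (by simp)
  have hd1 : ∀ᶠ t in 𝓝 (0 : ℝ), deriv φ t = fderiv ℝ f (z + t • c) c := by
    filter_upwards [hcont.eventually hev] with t ht
    exact ((ht.differentiableAt (by simp)).hasFDerivAt.comp_hasDerivAt t (hline t)).deriv
  have hd2 : deriv (deriv φ) 0 = secondDeriv f z c c := by
    rw [Filter.EventuallyEq.deriv_eq hd1]
    have h1 : DifferentiableAt ℝ (fun y => fderiv ℝ f y c) z :=
      ((hf.fderiv_right (m := 1) (by norm_num)).clm_apply contDiffAt_const).differentiableAt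
        (by simp)
    have h2 : HasFDerivAt (fun y => fderiv ℝ f y c) (fderiv ℝ (fun y => fderiv ℝ f y c) z)
        (z + (0 : ℝ) • c) := by simpa using h1.hasFDerivAt
    exact (h2.comp_hasDerivAt (0 : ℝ) (hline 0)).deriv
  have hmaxφ : IsLocalMax φ 0 := by
    have := hcont.eventually hmax
    simpa [IsLocalMax, IsMaxFilter, hφ] using this
  have hdiff0 : deriv φ 0 = 0 := hmaxφ.deriv_eq_zero
  have hcφ : ContinuousAt φ 0 := by
    have : ContinuousAt f (z + (0 : ℝ) • c) := by simpa using hf.continuousAt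
    exact ContinuousAt.comp (f := fun t : ℝ => z + t • c) this (hline 0).continuousAt
  have hminφ : IsLocalMin φ 0 :=
    isLocalMin_of_deriv_deriv_pos (by rw [hd2]; exact hpos) hdiff0 hcφ
  have hconst : φ =ᶠ[𝓝 0] fun _ => φ 0 := by
    filter_upwards [hmaxφ, hminφ] with t h1 h2 using le_antisymm h1 h2
  have : deriv (deriv φ) 0 = 0 := by
    rw [hconst.deriv.deriv_eq]; simp
  rw [hd2] at this
  exact hpos.ne' this

lemma secondDeriv_bilin {f : E → ℝ} {z : E} (hf : ContDiffAt ℝ 2 f z) (u v : E) :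
    secondDeriv f z u v = fderiv ℝ (fderiv ℝ f) z u v := by
  have h : DifferentiableAt ℝ (fderiv ℝ f) z :=
    (hf.fderiv_right (m := 1) (by norm_num)).differentiableAt (by simp)
  rw [secondDeriv, fderiv_clm_apply h (differentiableAt_const v)]
  simp

variable {n : ℕ}

local notation "𝔼" => EuclideanSpace ℝ (Fin n)

/-- The standard basis vectors. -/
noncomputable abbrev stdVec (i : Fin n) : 𝔼 := EuclideanSpace.single i (1 : ℝ)

/-- A second-order linear differential operator without zeroth-order term. -/
noncomputable def diffOp (a : 𝔼 → Matrix (Fin n) (Fin n) ℝ) (b : 𝔼 → Fin n → ℝ)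
    (f : 𝔼 → ℝ) (z : 𝔼) : ℝ :=
  ∑ i, ∑ j, a z i j * secondDeriv f z (stdVec i) (stdVec j) + ∑ i, b z i * fderiv ℝ f z (stdVec i)

lemma diffOp_add_smul (a : 𝔼 → Matrix (Fin n) (Fin n) ℝ) (b : 𝔼 → Fin n → ℝ) {f v : 𝔼 → ℝ} {z : 𝔼}
    (hf : ContDiffAt ℝ 2 f z) (hv : ContDiffAt ℝ 2 v z) (ε : ℝ) :
    diffOp a b (fun y => f y + ε * v y) z = diffOp a b f z + ε * diffOp a b v z := by
  have h1 : ∀ᶠ y in 𝓝 z, ∀ u, fderiv ℝ (fun y => f y + ε * v y) y u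
      = fderiv ℝ f y u + ε * fderiv ℝ v y u := by
    filter_upwards [hf.eventually (by simp), hv.eventually (by simp)] with y hfy hvy u
    have hd := (hfy.differentiableAt (by simp)).hasFDerivAt.add
      ((hvy.differentiableAt (by simp)).hasFDerivAt.const_mul ε)
    rw [show (fun y => f y + ε * v y) = f + fun y => ε * v y from rfl, hd.fderiv]
    simp
  have h2 : ∀ u w, secondDeriv (fun y => f y + ε * v y) z u w
      = secondDeriv f z u w + ε * secondDeriv v z u w := by
    intro u w
    have e : (fun y => fderiv ℝ (fun y => f y + ε * v y) y w) =ᶠ[𝓝 z]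
        fun y => fderiv ℝ f y w + ε * fderiv ℝ v y w := by
      filter_upwards [h1] with y hy using hy w
    have hf1 : DifferentiableAt ℝ (fun y => fderiv ℝ f y w) z :=
      ((hf.fderiv_right (m := 1) (by norm_num)).clm_apply contDiffAt_const).differentiableAt
        (by simp)
    have hv1 : DifferentiableAt ℝ (fun y => fderiv ℝ v y w) z :=
      ((hv.fderiv_right (m := 1) (by norm_num)).clm_apply contDiffAt_const).differentiableAt
        (by simp)
    have hd := hf1.hasFDerivAt.add (hv1.hasFDerivAt.const_mul ε)
    rw [secondDeriv, e.fderiv_eq]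
    rw [show (fun y => fderiv ℝ f y w + ε * fderiv ℝ v y w)
      = (fun y => fderiv ℝ f y w) + fun y => ε * fderiv ℝ v y w from rfl, hd.fderiv]
    simp [secondDeriv]
  simp only [diffOp, h2, h1.self_of_nhds, mul_add, Finset.sum_add_distrib, Finset.mul_sum]
  ring_nf
  simp only [mul_comm ε]
  ring

lemma diffOp_nonpos_of_isLocalMax {a : 𝔼 → Matrix (Fin n) (Fin n) ℝ} (b : 𝔼 → Fin n → ℝ)
    {f : 𝔼 → ℝ} {z : 𝔼} (ha : (a z).PosDef) (hf : ContDiffAt ℝ 2 f z) (hmax : IsLocalMax f z) :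
    diffOp a b f z ≤ 0 := by
  have h0 : fderiv ℝ f z = 0 := hmax.fderiv_eq_zero
  -- Writing the coefficient matrix as BᴴB turns its contraction with the Hessian into a sum of
  -- second derivatives along the rows of B, each of them nonpositive.
  obtain ⟨B, hB⟩ : ∃ B : Matrix (Fin n) (Fin n) ℝ, a z = B.conjTranspose * B := by
    open scoped MatrixOrder in
    exact CStarAlgebra.nonneg_iff_eq_star_mul_self.1 (Matrix.nonneg_iff_posSemidef.2 ha.posSemidef)
  have key : ∑ i, ∑ j, a z i j * secondDeriv f z (stdVec i) (stdVec j)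
      = ∑ k, secondDeriv f z (∑ i, B k i • stdVec i) (∑ i, B k i • stdVec i) := by
    simp only [secondDeriv_bilin hf, map_sum, map_smul, _root_.sum_apply,
      _root_.smul_apply, smul_eq_mul, hB, Matrix.mul_apply, Matrix.conjTranspose_apply,
      star_trivial, Finset.sum_mul, Finset.mul_sum]
    refine (Finset.sum_congr rfl fun i _ => Finset.sum_comm).trans ?_
    rw [Finset.sum_comm]
    refine Finset.sum_congr rfl fun k _ => ?_
    rw [Finset.sum_comm]
    refine Finset.sum_congr rfl fun j _ => Finset.sum_congr rfl fun i _ => by ring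
  rw [diffOp, key, h0]
  simpa using Finset.sum_nonpos fun k _ => secondDeriv_nonpos_of_isLocalMax hf hmax _

/-- The quadratic barrier of the strong maximum principle. -/
noncomputable def barrier (x₀ ν : 𝔼) (α : ℝ) (y : 𝔼) : ℝ :=
  inner ℝ ν (y - x₀) + α * inner ℝ ν (y - x₀) ^ 2 - ‖y - x₀‖ ^ 2

lemma contDiff_barrier (x₀ ν : 𝔼) (α : ℝ) : ContDiff ℝ 2 (barrier x₀ ν α) := by
  unfold barrier
  have h : ContDiff ℝ 2 fun y : 𝔼 => y - x₀ := contDiff_id.sub contDiff_const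
  have h' : ContDiff ℝ 2 fun y : 𝔼 => inner ℝ ν (y - x₀) := contDiff_const.inner ℝ h
  exact (h'.add (contDiff_const.mul (h'.pow 2))).sub (h.norm_sq ℝ)

lemma fderiv_barrier (x₀ ν : 𝔼) (α : ℝ) (y u : 𝔼) :
    fderiv ℝ (barrier x₀ ν α) y u =
      inner ℝ ν u * (1 + 2 * α * inner ℝ ν (y - x₀)) - 2 * inner ℝ (y - x₀) u := by
  have h : HasFDerivAt (fun y : 𝔼 => y - x₀) (ContinuousLinearMap.id ℝ 𝔼) y :=
    (hasFDerivAt_id y).sub_const x₀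
  have h' : HasFDerivAt (fun y : 𝔼 => inner ℝ ν (y - x₀)) (innerSL ℝ ν) y :=
    (innerSL ℝ ν).hasFDerivAt.comp y h
  have := (h'.add ((h'.pow 2).const_mul α)).sub h.norm_sq
  rw [show barrier x₀ ν α = _ from rfl, (this.congr_of_eventuallyEq (f₁ := barrier x₀ ν α)
    (Eventually.of_forall fun y => rfl)).fderiv]
  simp only [_root_.sub_apply, _root_.add_apply, _root_.smul_apply, innerSL_apply_apply,
    ContinuousLinearMap.comp_apply, ContinuousLinearMap.id_apply, smul_eq_mul, nsmul_eq_mul]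
  ring

lemma secondDeriv_barrier (x₀ ν : 𝔼) (α : ℝ) (y u v : 𝔼) :
    secondDeriv (barrier x₀ ν α) y u v = 2 * α * (inner ℝ ν u * inner ℝ ν v) - 2 * inner ℝ u v := by
  have h : HasFDerivAt (fun y : 𝔼 => y - x₀) (ContinuousLinearMap.id ℝ 𝔼) y :=
    (hasFDerivAt_id y).sub_const x₀
  have h' : ∀ w, HasFDerivAt (fun y : 𝔼 => inner ℝ w (y - x₀)) (innerSL ℝ w) y := fun w =>
    (innerSL ℝ w).hasFDerivAt.comp y h
  have := ((((h' ν).const_mul (2 * α)).const_add 1).const_mul (inner ℝ ν v)).sub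
    ((h' v).const_mul 2)
  rw [secondDeriv]
  simp only [fderiv_barrier]
  have e : (fun y => inner ℝ ν v * (1 + 2 * α * inner ℝ ν (y - x₀)) - 2 * inner ℝ (y - x₀) v)
      = fun y => inner ℝ ν v * (1 + 2 * α * inner ℝ ν (y - x₀)) - 2 * inner ℝ v (y - x₀) :=
    funext fun y => by rw [real_inner_comm v (y - x₀)]
  rw [e]
  rw [(this.congr_of_eventuallyEq (f₁ := fun y => inner ℝ ν v * (1 + 2 * α * inner ℝ ν (y - x₀))
    - 2 * inner ℝ v (y - x₀)) (Eventually.of_forall fun y => rfl)).fderiv]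
  simp only [_root_.sub_apply, _root_.smul_apply, innerSL_apply_apply, smul_eq_mul,
    real_inner_comm u v]
  ring

lemma diffOp_barrier (a : 𝔼 → Matrix (Fin n) (Fin n) ℝ) (b : 𝔼 → Fin n → ℝ) (x₀ ν : 𝔼) (α : ℝ)
    (y : 𝔼) : diffOp a b (barrier x₀ ν α) y =
      2 * α * (∑ i, ∑ j, a y i j * (ν i * ν j)) - 2 * (∑ i, a y i i)
        + ∑ i, b y i * (ν i * (1 + 2 * α * inner ℝ ν (y - x₀)) - 2 * (y - x₀) i) := by
  simp only [diffOp, secondDeriv_barrier, fderiv_barrier, stdVec, EuclideanSpace.inner_single_right]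
  have h : ∀ i j : Fin n, (EuclideanSpace.single i (1 : ℝ) : 𝔼) j = if i = j then 1 else 0 := by
    intro i j; simp [eq_comm]
  simp only [conj_trivial, one_mul, h, mul_sub, Finset.sum_sub_distrib, Finset.mul_sum]
  congr 1
  congr 1
  · exact Finset.sum_congr rfl fun i _ => Finset.sum_congr rfl fun j _ => by ring
  · exact Finset.sum_congr rfl fun i _ => by simp [mul_comm]

lemma continuousOn_diffOp_barrier {U : Set 𝔼} {a : 𝔼 → Matrix (Fin n) (Fin n) ℝ}
    {b : 𝔼 → Fin n → ℝ} (hac : ∀ i j, ContinuousOn (fun z => a z i j) U)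
    (hbc : ∀ i, ContinuousOn (fun z => b z i) U) (x₀ ν : 𝔼) (α : ℝ) :
    ContinuousOn (diffOp a b (barrier x₀ ν α)) U := by
  rw [show diffOp a b (barrier x₀ ν α) = _ from funext fun y => diffOp_barrier a b x₀ ν α y]
  have h : Continuous fun y : 𝔼 => inner ℝ ν (y - x₀) := by fun_prop
  refine ContinuousOn.add (ContinuousOn.sub (continuousOn_const.mul ?_)
    (continuousOn_const.mul ?_)) ?_
  · exact continuousOn_finsetSum _ fun i _ => continuousOn_finsetSum _ fun j _ =>
      (hac i j).mul continuousOn_const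
  · exact continuousOn_finsetSum _ fun i _ => hac i i
  · exact continuousOn_finsetSum _ fun i _ => (hbc i).mul (Continuous.continuousOn (by fun_prop))

/-- On a small sphere about `x₀`, the barrier is nonnegative only inside the ball about `x₀ + ν`
of radius `‖ν‖`. -/
lemma norm_sub_lt_of_barrier_nonneg {x₀ ν y : 𝔼} {α : ℝ} (hα : 0 ≤ α) (hy : y ≠ x₀)
    (hs : α * ‖ν‖ * ‖y - x₀‖ < 1) (hb : 0 ≤ barrier x₀ ν α y) : ‖y - (x₀ + ν)‖ < ‖ν‖ := by
  set ℓ : ℝ := inner ℝ ν (y - x₀) with hℓ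
  have hpos : 0 < ‖y - x₀‖ ^ 2 := by
    have : 0 < ‖y - x₀‖ := norm_pos_iff.2 (sub_ne_zero.2 hy)
    positivity
  have hle : |ℓ| ≤ ‖ν‖ * ‖y - x₀‖ := abs_real_inner_le_norm _ _
  have hαℓ : α * |ℓ| < 1 := by nlinarith
  have hb' : ‖y - x₀‖ ^ 2 ≤ ℓ * (1 + α * ℓ) := by
    have : barrier x₀ ν α y = ℓ + α * ℓ ^ 2 - ‖y - x₀‖ ^ 2 := rfl
    nlinarith
  -- Since |αℓ| < 1, the factor 1 + αℓ lies strictly between 0 and 2. Hence ℓ > 0 and ‖y - x₀‖² <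
  -- 2ℓ, which is membership in the ball.
  have h2 : -(α * ℓ) < 1 := by
    nlinarith [neg_abs_le ℓ, mul_le_mul_of_nonneg_left (neg_abs_le ℓ) hα]
  have h3 : α * ℓ < 1 := lt_of_le_of_lt (mul_le_mul_of_nonneg_left (le_abs_self ℓ) hα) hαℓ
  have hℓpos : 0 < ℓ := by
    by_contra! h
    nlinarith
  have h4 : ‖y - x₀‖ ^ 2 < 2 * ℓ := by nlinarith
  have h5 : ‖y - (x₀ + ν)‖ ^ 2 = ‖y - x₀‖ ^ 2 - 2 * ℓ + ‖ν‖ ^ 2 := by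
    rw [← sub_sub, norm_sub_sq_real, real_inner_comm]
  exact lt_of_pow_lt_pow_left₀ 2 (norm_nonneg _) (by linarith)

/-- Strong maximum principle: a solution of an elliptic equation that attains its maximum at an
interior point is constant near that point. -/
theorem eventually_eq_of_diffOp_eq_zero {U : Set 𝔼} (hU : IsOpen U)
    {a : 𝔼 → Matrix (Fin n) (Fin n) ℝ} {b : 𝔼 → Fin n → ℝ}
    (hac : ∀ i j, ContinuousOn (fun z => a z i j) U) (hbc : ∀ i, ContinuousOn (fun z => b z i) U)
    (ha : ∀ z ∈ U, (a z).PosDef) {f : 𝔼 → ℝ} (hf : ContDiffOn ℝ 2 f U)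
    (hL : ∀ z ∈ U, diffOp a b f z = 0) {m : ℝ} (hm : ∀ z ∈ U, f z ≤ m) {z₀ : 𝔼} (hz₀ : z₀ ∈ U)
    (hfz₀ : f z₀ = m) : ∀ᶠ z in 𝓝 z₀, f z = m := by
  obtain ⟨r, hr, hrU⟩ := Metric.isOpen_iff.1 hU z₀ hz₀
  have hcont : ContinuousOn f U := hf.continuousOn
  have hfat : ∀ z ∈ U, ContDiffAt ℝ 2 f z := fun z hz => hf.contDiffAt (hU.mem_nhds hz)
  -- With q within r/4 of z₀, its distance to the maximum set K is also below r/4, so the ball about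
  -- q touching K stays within r/2 of z₀.
  filter_upwards [Metric.ball_mem_nhds z₀ (show 0 < r / 4 by positivity)] with q hq
  by_contra hfq
  have hqU : Metric.closedBall z₀ (r / 2) ⊆ U :=
    (Metric.closedBall_subset_ball (by linarith)).trans hrU
  set K : Set 𝔼 := {z ∈ Metric.closedBall z₀ (r / 2) | f z = m} with hK
  have hKc : IsCompact K := by
    have : IsClosed K := by
      have := (hcont.mono hqU).preimage_isClosed_of_isClosed Metric.isClosed_closedBall
        (isClosed_singleton (x := m))
      exact this
    exact (isCompact_closedBall z₀ (r / 2)).of_isClosed_subset this fun z hz => hz.1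
  have hz₀K : z₀ ∈ K := ⟨Metric.mem_closedBall_self (by positivity), hfz₀⟩
  obtain ⟨x₀, hx₀K, hx₀⟩ := hKc.exists_infDist_eq_dist ⟨z₀, hz₀K⟩ q
  have hmin : ∀ y ∈ K, dist q x₀ ≤ dist q y := fun y hy => hx₀ ▸ Metric.infDist_le_dist_of_mem hy
  have hx₀U : x₀ ∈ U := hqU hx₀K.1
  set ν : 𝔼 := q - x₀ with hν
  have hν0 : ν ≠ 0 := fun h => hfq (by rw [sub_eq_zero.1 h]; exact hx₀K.2)
  have hνn : ‖ν‖ = dist q x₀ := (dist_eq_norm _ _).symm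
  have hνlt : ‖ν‖ < r / 4 := by
    rw [hνn]; exact (hmin z₀ hz₀K).trans_lt hq
  -- The centre x₀ + ν is q, and x₀ is a point of K nearest to q, so the open ball contains no
  -- maximum point.
  have hin : ∀ y, ‖y - (x₀ + ν)‖ < ‖ν‖ → f y < m := by
    intro y hy
    have hy' : dist q y < dist q x₀ := by
      rw [← hνn, dist_comm, dist_eq_norm]
      simpa [hν] using hy
    have hyz : y ∈ Metric.closedBall z₀ (r / 2) := by
      rw [Metric.mem_closedBall]
      have := dist_triangle_left y z₀ q
      have hq' : dist q z₀ < r / 4 := hq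
      linarith
    refine lt_of_le_of_ne (hm y (hqU hyz)) fun h => ?_
    exact absurd (hmin y ⟨hyz, h⟩) (not_le.2 hy')
  have hquad : 0 < ∑ i, ∑ j, a x₀ i j * (ν i * ν j) := by
    have hne : (fun i => ν i) ≠ 0 := fun h => hν0 (by ext i; exact congrFun h i)
    have := (ha x₀ hx₀U).dotProduct_mulVec_pos hne
    simp only [dotProduct, Matrix.mulVec, star_trivial, Pi.star_apply, Finset.mul_sum] at this
    refine this.trans_eq (Finset.sum_congr rfl fun i _ => Finset.sum_congr rfl fun j _ => by ring)
  -- At x₀ the operator applied to the barrier is 2αQ + c, with Q > 0 by ellipticity and c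
  -- independent of α. A large α therefore makes it positive.
  obtain ⟨α, hα, hLv⟩ : ∃ α : ℝ, 0 ≤ α ∧ 0 < diffOp a b (barrier x₀ ν α) x₀ := by
    set Q := ∑ i, ∑ j, a x₀ i j * (ν i * ν j)
    set c := - 2 * (∑ i, a x₀ i i) + ∑ i, b x₀ i * ν i
    refine ⟨(|c| + 1) / Q, by positivity, ?_⟩
    have : diffOp a b (barrier x₀ ν ((|c| + 1) / Q)) x₀ = 2 * (|c| + 1) + c := by
      rw [diffOp_barrier]
      rw [sub_self, inner_zero_right]
      simp only [PiLp.zero_apply, mul_zero, add_zero, mul_one, sub_zero]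
      change 2 * ((|c| + 1) / Q) * Q - _ + _ = _
      have : 2 * ((|c| + 1) / Q) * Q = 2 * (|c| + 1) := by field_simp
      rw [this]
      ring
    rw [this]
    linarith [neg_abs_le c, abs_nonneg c]
  have hnear : ∀ᶠ y in 𝓝 x₀, y ∈ U ∧ 0 < diffOp a b (barrier x₀ ν α) y :=
    Filter.Eventually.and (hU.mem_nhds hx₀U)
      (((continuousOn_diffOp_barrier hac hbc x₀ ν α).continuousAt (hU.mem_nhds hx₀U)).eventually
        (lt_mem_nhds hLv))
  obtain ⟨s₀, hs₀, hs₀b⟩ := Metric.eventually_nhds_iff.1 hnear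
  obtain ⟨s, hs, hss₀, hsα⟩ : ∃ s : ℝ, 0 < s ∧ s < s₀ ∧ α * ‖ν‖ * s < 1 := by
    refine ⟨min (s₀ / 2) (1 / (2 * (α * ‖ν‖ + 1))), by positivity, ?_, ?_⟩
    · exact (min_le_left _ _).trans_lt (by linarith)
    · calc α * ‖ν‖ * min (s₀ / 2) (1 / (2 * (α * ‖ν‖ + 1)))
          ≤ α * ‖ν‖ * (1 / (2 * (α * ‖ν‖ + 1))) := by gcongr; exact min_le_right _ _
        _ < 1 := by
          rw [mul_one_div, div_lt_one (by positivity)]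
          nlinarith [show 0 ≤ α * ‖ν‖ by positivity]
  have hball : ∀ y ∈ Metric.closedBall x₀ s, y ∈ U ∧ 0 < diffOp a b (barrier x₀ ν α) y :=
    fun y hy => hs₀b (lt_of_le_of_lt hy hss₀)
  have hvc : Continuous (barrier x₀ ν α) := (contDiff_barrier x₀ ν α).continuous
  -- On the part P of the sphere where the barrier is nonnegative, f < m, with a uniform gap by
  -- compactness. Off P the barrier is negative and f ≤ m already suffices.
  obtain ⟨ε, hε, hsph⟩ : ∃ ε : ℝ, 0 < ε ∧
      ∀ y ∈ Metric.sphere x₀ s, f y + ε * barrier x₀ ν α y < m := by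
    set P : Set 𝔼 := {y ∈ Metric.sphere x₀ s | 0 ≤ barrier x₀ ν α y} with hP
    have hPc : IsCompact P :=
      (isCompact_sphere x₀ s).inter_right (isClosed_le continuous_const hvc)
    have hPm : ∀ y ∈ P, f y < m := fun y hy => by
      have hyn : ‖y - x₀‖ = s := by rw [← dist_eq_norm]; exact hy.1
      refine hin y (norm_sub_lt_of_barrier_nonneg hα ?_ (by rw [hyn]; exact hsα) hy.2)
      rintro rfl
      simp at hyn
      exact hs.ne hyn
    have hout : ∀ ε > 0, ∀ y ∈ Metric.sphere x₀ s, y ∉ P → f y + ε * barrier x₀ ν α y < m := by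
      intro ε hε y hy hyP
      have h1 : barrier x₀ ν α y < 0 := by
        by_contra! h
        exact hyP ⟨hy, h⟩
      have h2 := hm y (hball y (Metric.sphere_subset_closedBall hy)).1
      nlinarith [mul_neg_of_pos_of_neg hε h1]
    rcases P.eq_empty_or_nonempty with hPe | hPne
    · exact ⟨1, one_pos, fun y hy => hout 1 one_pos y hy (by simp [hPe])⟩
    obtain ⟨y₁, hy₁, hy₁max⟩ := hPc.exists_isMaxOn hPne
      (hcont.mono fun y hy => (hball y (Metric.sphere_subset_closedBall hy.1)).1)
    obtain ⟨y₂, hy₂, hy₂max⟩ := hPc.exists_isMaxOn hPne hvc.continuousOn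
    have hδ : 0 < m - f y₁ := sub_pos.2 (hPm y₁ hy₁)
    have hV : 0 ≤ barrier x₀ ν α y₂ := hy₂.2
    set V := barrier x₀ ν α y₂
    -- V is the maximum of the barrier on P; this ε keeps εV below the gap m - f y₁, and the added 1
    -- covers V = 0.
    refine ⟨(m - f y₁) / (2 * (V + 1)), by positivity, fun y hy => ?_⟩
    by_cases hyP : y ∈ P
    · have h1 : f y ≤ f y₁ := hy₁max hyP
      have h2 : barrier x₀ ν α y ≤ V := hy₂max hyP
      have h3 : (m - f y₁) / (2 * (V + 1)) * barrier x₀ ν α y ≤ (m - f y₁) / (2 * (V + 1)) * V := by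
        gcongr
      have h4 : (m - f y₁) / (2 * (V + 1)) * V < m - f y₁ := by
        rw [div_mul_eq_mul_div, div_lt_iff₀ (by positivity)]
        nlinarith
      linarith
    · exact hout _ (by positivity) y hy hyP
  -- The perturbed function equals m at x₀ and is below m on the sphere, so its maximum is interior.
  -- There the operator is at most 0, yet it equals ε times its positive value on the barrier.
  obtain ⟨y, hyB, hymax⟩ := (isCompact_closedBall x₀ s).exists_isMaxOn
    ⟨x₀, Metric.mem_closedBall_self hs.le⟩ (f := fun y => f y + ε * barrier x₀ ν α y)
    ((hcont.mono fun y hy => (hball y hy).1).add (continuousOn_const.mul hvc.continuousOn))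
  have hx₀val : f x₀ + ε * barrier x₀ ν α x₀ = m := by simp [barrier, hx₀K.2]
  have hyge : m ≤ f y + ε * barrier x₀ ν α y :=
    hx₀val ▸ hymax (Metric.mem_closedBall_self hs.le)
  have hyball : y ∈ Metric.ball x₀ s := by
    refine lt_of_le_of_ne (Metric.mem_closedBall.1 hyB) fun h => ?_
    exact absurd (hsph y h) (not_lt.2 hyge)
  have hyloc : IsLocalMax (fun y => f y + ε * barrier x₀ ν α y) y :=
    hymax.isLocalMax (Filter.mem_of_superset (Metric.isOpen_ball.mem_nhds hyball)
      Metric.ball_subset_closedBall)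
  have hyU := (hball y hyB).1
  have hvy : ContDiffAt ℝ 2 (barrier x₀ ν α) y := (contDiff_barrier x₀ ν α).contDiffAt
  have h1 := diffOp_nonpos_of_isLocalMax b (ha y hyU)
    ((hfat y hyU).add (contDiffAt_const.mul hvy)) hyloc
  rw [diffOp_add_smul a b (hfat y hyU) hvy, hL y hyU, zero_add] at h1
  exact absurd h1 (not_le.2 (mul_pos hε (hball y hyB).2))

end MaximumPrinciple

/-! ### Riemannian metrics on open sets: inverse metric, Christoffel symbols, volume density. -/

section LocalGeometry

set_option linter.unusedSectionVars false

open Topology Filter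

variable {E : Type*} [NormedAddCommGroup E] [InnerProductSpace ℝ E] [FiniteDimensional ℝ E]
  {ι : Type*} [Fintype ι] (e : OrthonormalBasis ι ℝ E)

local notation "⟪" x ", " y "⟫" => inner ℝ x y

/-- The trace of an endomorphism of a Euclidean space, as a continuous linear functional. -/
noncomputable def trc : (E →L[ℝ] E) →L[ℝ] ℝ :=
  LinearMap.toContinuousLinearMap
    ((LinearMap.trace ℝ E).comp (ContinuousLinearMap.coeLM ℝ : (E →L[ℝ] E) →ₗ[ℝ] E →ₗ[ℝ] E))

lemma trc_eq_trace (L : E →L[ℝ] E) : trc L = LinearMap.trace ℝ E (L : E →ₗ[ℝ] E) := rfl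

lemma trc_apply (L : E →L[ℝ] E) : trc L = ∑ k, ⟪L (e k), e k⟫ := by
  rw [trc_eq_trace, LinearMap.trace_eq_sum_inner _ e]
  exact Finset.sum_congr rfl fun k _ => real_inner_comm _ _

lemma trc_mul_comm (L M : E →L[ℝ] E) : trc (L * M) = trc (M * L) := by
  simp only [trc_eq_trace]
  exact LinearMap.trace_mul_comm ℝ (L : E →ₗ[ℝ] E) (M : E →ₗ[ℝ] E)

/-- A smooth Riemannian metric `(z, u, v) ↦ ⟪G z u, v⟫` on an open subset of Euclidean space. -/
structure IsMetricOn (G : E → E →L[ℝ] E) (U : Set E) : Prop where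
  isOpen : IsOpen U
  contDiffOn : ContDiffOn ℝ ∞ G U
  symm : ∀ z ∈ U, ∀ u v, ⟪G z u, v⟫ = ⟪G z v, u⟫
  pos : ∀ z ∈ U, ∀ u, u ≠ 0 → 0 < ⟪G z u, u⟫

/-- The inverse metric. -/
noncomputable def invMetric (G : E → E →L[ℝ] E) (z : E) : E →L[ℝ] E := Ring.inverse (G z)

/-- The logarithmic derivative of the volume density. -/
noncomputable def theta (G : E → E →L[ℝ] E) (z u : E) : ℝ :=
  trc (invMetric G z * fderiv ℝ G z u) / 2

/-- The Christoffel symbols. -/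
noncomputable def gam (G : E → E →L[ℝ] E) (z u v : E) : E :=
  invMetric G z ((1 / 2 : ℝ) • (fderiv ℝ G z u v + fderiv ℝ G z v u
    - ∑ k, ⟪fderiv ℝ G z (stdOrthonormalBasis ℝ E k) u, v⟫ • stdOrthonormalBasis ℝ E k))

lemma theta_eq_sum (G : E → E →L[ℝ] E) (z u : E) :
    theta G z u = ∑ k, theta G z (e k) * ⟪u, e k⟫ := by
  conv_lhs => rw [← e.sum_repr' u]
  simp only [theta, map_sum, map_smul, Finset.mul_sum, Finset.sum_div]
  refine Finset.sum_congr rfl fun k _ => ?_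
  rw [mul_smul_comm, map_smul, smul_eq_mul, real_inner_comm]
  ring

namespace IsMetricOn

variable {G : E → E →L[ℝ] E} {U : Set E} {z : E}

lemma contDiffAt (hG : IsMetricOn G U) (hz : z ∈ U) : ContDiffAt ℝ ∞ G z :=
  hG.contDiffOn.contDiffAt (hG.isOpen.mem_nhds hz)

lemma differentiableAt (hG : IsMetricOn G U) (hz : z ∈ U) : DifferentiableAt ℝ G z :=
  (hG.contDiffAt hz).differentiableAt (by simp)

lemma isUnit (hG : IsMetricOn G U) (hz : z ∈ U) : IsUnit (G z) := by
  have hinj : Function.Injective (G z) := by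
    refine (injective_iff_map_eq_zero _).2 fun u hu => ?_
    by_contra h
    have := hG.pos z hz u h
    rw [hu, inner_zero_left] at this
    exact this.ne rfl
  rw [ContinuousLinearMap.isUnit_iff_bijective]
  exact ⟨hinj, LinearMap.injective_iff_surjective.1 hinj⟩

lemma mul_invMetric (hG : IsMetricOn G U) (hz : z ∈ U) : G z * invMetric G z = 1 :=
  Ring.mul_inverse_cancel _ (hG.isUnit hz)

lemma invMetric_mul (hG : IsMetricOn G U) (hz : z ∈ U) : invMetric G z * G z = 1 :=
  Ring.inverse_mul_cancel _ (hG.isUnit hz)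

lemma apply_invMetric (hG : IsMetricOn G U) (hz : z ∈ U) (u : E) : G z (invMetric G z u) = u :=
  DFunLike.congr_fun (hG.mul_invMetric hz) u

lemma invMetric_apply (hG : IsMetricOn G U) (hz : z ∈ U) (u : E) : invMetric G z (G z u) = u :=
  DFunLike.congr_fun (hG.invMetric_mul hz) u

lemma invMetric_symm (hG : IsMetricOn G U) (hz : z ∈ U) (u v : E) :
    ⟪invMetric G z u, v⟫ = ⟪invMetric G z v, u⟫ := by
  conv_lhs => rw [← hG.apply_invMetric hz v]
  conv_rhs => rw [← hG.apply_invMetric hz u]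
  rw [real_inner_comm, hG.symm z hz, real_inner_comm]

lemma invMetric_pos (hG : IsMetricOn G U) (hz : z ∈ U) {u : E} (hu : u ≠ 0) :
    0 < ⟪invMetric G z u, u⟫ := by
  have h : invMetric G z u ≠ 0 := fun h => hu (by rw [← hG.apply_invMetric hz u, h, map_zero])
  have := hG.pos z hz _ h
  rwa [hG.apply_invMetric hz, real_inner_comm] at this

lemma eventually_mem (hG : IsMetricOn G U) (hz : z ∈ U) : ∀ᶠ y in 𝓝 z, y ∈ U :=
  hG.isOpen.mem_nhds hz

lemma fderiv_symm (hG : IsMetricOn G U) (hz : z ∈ U) (a u v : E) :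
    ⟪fderiv ℝ G z a u, v⟫ = ⟪fderiv ℝ G z a v, u⟫ := by
  have key : ∀ u v : E, fderiv ℝ (fun y => ⟪G y u, v⟫) z a = ⟪fderiv ℝ G z a u, v⟫ := fun u v => by
    have h := ((hG.differentiableAt hz).hasFDerivAt.clm_apply (hasFDerivAt_const u z)).inner ℝ
      (hasFDerivAt_const v z)
    rw [h.fderiv]
    simp
  rw [← key, ← key]
  have : (fun y => ⟪G y u, v⟫) =ᶠ[𝓝 z] fun y => ⟪G y v, u⟫ := by
    filter_upwards [hG.eventually_mem hz] with y hy using hG.symm y hy u v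
  rw [this.fderiv_eq]

/-- The sum over the basis in `gam` represents the functional w ↦ ⟪∂_w G u, v⟫; applying G removes
the inverse metric and leaves Christoffel symbols of the first kind. -/
lemma apply_gam (hG : IsMetricOn G U) (hz : z ∈ U) (u v w : E) : ⟪G z (gam G z u v), w⟫ =
    (⟪fderiv ℝ G z u v, w⟫ + ⟪fderiv ℝ G z v u, w⟫ - ⟪fderiv ℝ G z w u, v⟫) / 2 := by
  have h : ⟪∑ k, ⟪fderiv ℝ G z (stdOrthonormalBasis ℝ E k) u, v⟫ • stdOrthonormalBasis ℝ E k, w⟫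
      = ⟪fderiv ℝ G z w u, v⟫ := by
    conv_rhs => rw [← (stdOrthonormalBasis ℝ E).sum_repr' w]
    simp only [sum_inner, inner_smul_left, conj_trivial, map_sum, map_smul, _root_.sum_apply,
      _root_.smul_apply]
    exact Finset.sum_congr rfl fun k _ => mul_comm _ _
  rw [gam, hG.apply_invMetric hz, inner_smul_left, inner_sub_left, inner_add_left, h]
  simp
  ring

lemma contDiffAt_invMetric (hG : IsMetricOn G U) (hz : z ∈ U) : ContDiffAt ℝ ∞ (invMetric G) z := by
  obtain ⟨e, he⟩ := hG.isUnit hz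
  exact ContDiffAt.comp z (g := Ring.inverse) (he ▸ contDiffAt_ringInverse ℝ e) (hG.contDiffAt hz)

lemma fderiv_invMetric (hG : IsMetricOn G U) (hz : z ∈ U) (u : E) : fderiv ℝ (invMetric G) z u =
    -(invMetric G z * fderiv ℝ G z u * invMetric G z) := by
  obtain ⟨e, he⟩ := hG.isUnit hz
  have h1 : HasFDerivAt Ring.inverse (-ContinuousLinearMap.mulLeftRight ℝ (E →L[ℝ] E) ↑e⁻¹ ↑e⁻¹)
      (G z) := he ▸ hasFDerivAt_ringInverse e
  have h2 := h1.comp z (hG.differentiableAt hz).hasFDerivAt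
  rw [show invMetric G = Ring.inverse ∘ G from rfl, h2.fderiv]
  have h3 : (↑e⁻¹ : E →L[ℝ] E) = Ring.inverse (G z) := by rw [← he, Ring.inverse_unit]
  rw [h3]
  simp [mul_assoc]

lemma contDiffAt_fderiv_apply (hG : IsMetricOn G U) (hz : z ∈ U) (u : E) :
    ContDiffAt ℝ ∞ (fun y => fderiv ℝ G y u) z :=
  ((hG.contDiffAt hz).fderiv_right (m := ∞) (by simp)).clm_apply contDiffAt_const

lemma contDiffAt_theta (hG : IsMetricOn G U) (hz : z ∈ U) (u : E) :
    ContDiffAt ℝ ∞ (fun y => theta G y u) z := by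
  have h := (hG.contDiffAt_invMetric hz).mul (hG.contDiffAt_fderiv_apply hz u)
  exact (trc.contDiff.contDiffAt.comp z h).div_const 2

set_option synthInstance.maxHeartbeats 200000 in
set_option maxHeartbeats 800000 in
/-- The logarithmic derivative of the volume density is a closed form. -/
lemma fderiv_theta_symm (hG : IsMetricOn G U) (hz : z ∈ U) (u v : E) :
    fderiv ℝ (fun y => theta G y u) z v = fderiv ℝ (fun y => theta G y v) z u := by
  -- Of the two terms, the first is symmetric in u and v by the symmetry of second derivatives, the
  -- second by cyclicity of the trace. No determinant is needed.
  have key : ∀ u v : E, fderiv ℝ (fun y => theta G y u) z v =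
      (trc (invMetric G z * fderiv ℝ (fderiv ℝ G) z v u)
        - trc (invMetric G z * fderiv ℝ G z v * (invMetric G z * fderiv ℝ G z u))) / 2 := by
    intro u v
    have hd : DifferentiableAt ℝ (fderiv ℝ G) z :=
      ((hG.contDiffAt hz).fderiv_right (m := 1) (by norm_cast)).differentiableAt (by simp)
    have h1 : HasFDerivAt (fun y => fderiv ℝ G y u) _ z :=
      hd.hasFDerivAt.clm_apply (hasFDerivAt_const u z)
    have h2 := ((hG.contDiffAt_invMetric hz).differentiableAt (by simp)).hasFDerivAt
    have h3 := (trc.hasFDerivAt.comp z (h2.mul' h1)).mul_const (1 / 2 : ℝ)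
    have e : (fun y => theta G y u) =
        fun y => (trc ∘ fun y => invMetric G y * fderiv ℝ G y u) y * (1 / 2 : ℝ) :=
      funext fun y => by simp [theta, div_eq_mul_inv]
    rw [e]
    have h4 : HasFDerivAt (fun y => (trc ∘ fun y => invMetric G y * fderiv ℝ G y u) y * (1 / 2 : ℝ))
      _ z := h3
    rw [h4.fderiv]
    simp [hG.fderiv_invMetric hz, mul_assoc]
    ring
  rw [key, key, trc_mul_comm (invMetric G z * fderiv ℝ G z v)]
  have hs : IsSymmSndFDerivAt ℝ G z :=
    ((hG.contDiffAt hz).of_le (m := 2) (by norm_cast)).isSymmSndFDerivAt (by simp)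
  rw [hs.eq u v]

end IsMetricOn

end LocalGeometry

/-! ### Divergence of vector fields and of 2-forms in coordinates. -/

section LocalGeometry

set_option linter.unusedSectionVars false

open Topology Filter

variable {E : Type*} [NormedAddCommGroup E] [InnerProductSpace ℝ E] [FiniteDimensional ℝ E]
  {ι κ : Type*} [Fintype ι] [Fintype κ] (e : OrthonormalBasis ι ℝ E)

local notation "⟪" x ", " y "⟫" => inner ℝ x y

/-- A frame that is orthonormal for the metric `(u, v) ↦ ⟪G z u, v⟫`. -/
def IsFrameAt (G : E → E →L[ℝ] E) (z : E) (b : κ → E) : Prop :=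
  ∀ u v, ∑ j, ⟪u, b j⟫ * ⟪v, b j⟫ = ⟪invMetric G z u, v⟫

variable {G : E → E →L[ℝ] E} {U : Set E} {z : E} {b : κ → E}

/-- Orthonormality is used as completeness: ∑ bⱼ ⊗ bⱼ is the inverse metric. Traces need nothing
more. -/
lemma IsFrameAt.sum_smul (hb : IsFrameAt G z b) (u : E) :
    ∑ j, ⟪u, b j⟫ • b j = invMetric G z u := by
  refine ext_inner_right ℝ fun v => ?_
  simp only [sum_inner, inner_smul_left, conj_trivial]
  rw [← hb u v]
  exact Finset.sum_congr rfl fun k _ => by rw [real_inner_comm v]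

lemma IsFrameAt.sum_inner_apply (hb : IsFrameAt G z b) (C : E →L[ℝ] E) :
    ∑ j, ⟪C (b j), b j⟫ = trc (C * invMetric G z) := by
  rw [trc_apply (stdOrthonormalBasis ℝ E)]
  simp only [_root_.mul_apply_eq_comp, ← hb.sum_smul, map_sum, map_smul, sum_inner,
    inner_smul_left, conj_trivial]
  rw [Finset.sum_comm]
  refine Finset.sum_congr rfl fun j _ => ?_
  rw [← (stdOrthonormalBasis ℝ E).sum_inner_mul_inner]
  exact Finset.sum_congr rfl fun k _ => mul_comm _ _

/-- The contraction of an antisymmetric form with a symmetric one vanishes. -/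
lemma sum_sum_antisymm_mul_symm {p q : κ → κ → ℝ} (hp : ∀ i j, p i j = -p j i)
    (hq : ∀ i j, q i j = q j i) : ∑ i, ∑ j, p i j * q i j = 0 := by
  have : ∑ i, ∑ j, p i j * q i j = -∑ i, ∑ j, p i j * q i j := by
    conv_lhs => rw [Finset.sum_comm]
    simp only [← Finset.sum_neg_distrib]
    exact Finset.sum_congr rfl fun i _ => Finset.sum_congr rfl fun j _ => by rw [hp, hq]; ring
  linarith

/-- The covariant divergence of a vector field in coordinates. -/
noncomputable def coordDiv (G : E → E →L[ℝ] E) (Y : E → E) (z : E) : ℝ :=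
  trc (fderiv ℝ Y z) + theta G z (Y z)

namespace IsMetricOn

/-- Two of the three Christoffel terms cancel because ∂G is symmetric; what remains is half the
trace of G⁻¹ ∂_Y G. -/
lemma sum_inner_gam (hG : IsMetricOn G U) (hz : z ∈ U) (hb : IsFrameAt G z b) (Y : E) :
    ∑ j, ⟪G z (gam G z (b j) Y), b j⟫ = theta G z Y := by
  have h : ∀ j, ⟪G z (gam G z (b j) Y), b j⟫ = ⟪fderiv ℝ G z Y (b j), b j⟫ / 2 := fun j => by
    rw [hG.apply_gam hz, hG.fderiv_symm hz (b j) (b j) Y]; ring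
  simp only [h, ← Finset.sum_div]
  rw [hb.sum_inner_apply, trc_mul_comm]; rfl

/-- The divergence as the trace of the covariant derivative. -/
lemma coordDiv_eq_sum (hG : IsMetricOn G U) (hz : z ∈ U) (hb : IsFrameAt G z b) (Y : E → E) :
    coordDiv G Y z = ∑ j, ⟪G z (fderiv ℝ Y z (b j) + gam G z (b j) (Y z)), b j⟫ := by
  simp only [map_add, inner_add_left, Finset.sum_add_distrib]
  rw [hG.sum_inner_gam hz hb, coordDiv]
  congr 1
  have := hb.sum_inner_apply (G z * fderiv ℝ Y z)
  rw [mul_assoc, trc_mul_comm, mul_assoc, hG.invMetric_mul hz, mul_one] at this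
  exact this.symm

/-- The divergence of a vector field in terms of the dual `1`-form. -/
lemma coordDiv_eq_sum_dual (hG : IsMetricOn G U) (hz : z ∈ U) (hb : IsFrameAt G z b) {Y : E → E}
    (hY : DifferentiableAt ℝ Y z) :
    coordDiv G Y z = ∑ j, (⟪fderiv ℝ (fun y => G y (Y y)) z (b j), b j⟫
      - ⟪G z (Y z), gam G z (b j) (b j)⟫) := by
  have h : fderiv ℝ (fun y => G y (Y y)) z = (G z).comp (fderiv ℝ Y z)
      + (fderiv ℝ G z).flip (Y z) :=
    fderiv_clm_apply (hG.differentiableAt hz) hY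
  rw [hG.coordDiv_eq_sum hz hb]
  refine Finset.sum_congr rfl fun j _ => ?_
  have h2 : ⟪G z (Y z), gam G z (b j) (b j)⟫ = ⟪G z (gam G z (b j) (b j)), Y z⟫ :=
    hG.symm z hz _ _
  rw [h, h2, hG.apply_gam hz]
  simp only [map_add, inner_add_left, _root_.add_apply, ContinuousLinearMap.comp_apply,
    ContinuousLinearMap.flip_apply]
  rw [hG.apply_gam hz, hG.fderiv_symm hz (b j) (b j) (Y z)]
  ring

/-- The divergence of a `2`-form `A`, contracted with the vector field dual to a constant form, is
the divergence of a vector field. -/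
lemma sum_covDeriv_eq_coordDiv (hG : IsMetricOn G U) (hz : z ∈ U) (hb : IsFrameAt G z b)
    {A : E → E →L[ℝ] E} (hA : DifferentiableAt ℝ A z)
    (hanti : ∀ y ∈ U, ∀ u v, ⟪A y u, v⟫ = -⟪A y v, u⟫) (w : E) :
    ∑ j, (⟪fderiv ℝ A z (b j) (b j), invMetric G z w⟫
      - ⟪A z (gam G z (b j) (b j)), invMetric G z w⟫
      - ⟪A z (b j), gam G z (b j) (invMetric G z w)⟫)
    = coordDiv G (fun y => -invMetric G y (A y (invMetric G y w))) z := by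
  have hHd : DifferentiableAt ℝ (invMetric G) z :=
    (hG.contDiffAt_invMetric hz).differentiableAt (by simp)
  have hWd : DifferentiableAt ℝ (fun y => invMetric G y w) z :=
    hHd.clm_apply (differentiableAt_const w)
  set W := invMetric G z w with hW
  have hAanti : ∀ a u v, ⟪fderiv ℝ A z a u, v⟫ = -⟪fderiv ℝ A z a v, u⟫ := by
    intro a u v
    have key : ∀ u v : E, fderiv ℝ (fun y => ⟪A y u, v⟫) z a = ⟪fderiv ℝ A z a u, v⟫ :=
      fun u v => by
      have h := (hA.hasFDerivAt.clm_apply (hasFDerivAt_const u z)).inner ℝ (hasFDerivAt_const v z)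
      rw [h.fderiv]
      simp
    rw [← key, ← key]
    have : (fun y => ⟪A y u, v⟫) =ᶠ[𝓝 z] fun y => -⟪A y v, u⟫ := by
      filter_upwards [hG.eventually_mem hz] with y hy using hanti y hy u v
    rw [this.fderiv_eq, fderiv_fun_neg]; rfl
  have hDW : ∀ u, fderiv ℝ (fun y => invMetric G y w) z u
      = -invMetric G z (fderiv ℝ G z u W) := by
    intro u
    rw [fderiv_clm_apply hHd (differentiableAt_const w)]
    simp [hG.fderiv_invMetric hz, hW]
  have hGY : (fun y => G y (-invMetric G y (A y (invMetric G y w)))) =ᶠ[𝓝 z]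
      fun y => -(A y (invMetric G y w)) := by
    filter_upwards [hG.eventually_mem hz] with y hy
    rw [map_neg, hG.apply_invMetric hy]
  have hYd : DifferentiableAt ℝ (fun y => -invMetric G y (A y (invMetric G y w))) z :=
    (hHd.clm_apply (hA.clm_apply hWd)).neg
  rw [hG.coordDiv_eq_sum_dual hz hb hYd, ← sub_eq_zero, ← Finset.sum_sub_distrib]
  have hterm : ∀ u, fderiv ℝ (fun y => G y (-invMetric G y (A y (invMetric G y w)))) z u
      = -(fderiv ℝ A z u W + A z (fderiv ℝ (fun y => invMetric G y w) z u)) := by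
    intro u
    rw [hGY.fderiv_eq, fderiv_fun_neg, fderiv_clm_apply hA hWd]
    simp [add_comm, hW]
  -- S is the covariant derivative of W. As W is dual to the constant form w, which is closed, S is
  -- symmetric for G. The Leibniz term ∑ ⟪A bⱼ, S bⱼ⟫ pairs it with the antisymmetric A and
  -- vanishes, leaving exactly the two sides of the claim.
  set S : E → E := fun u => fderiv ℝ (fun y => invMetric G y w) z u + gam G z u W with hS
  have hSsymm : ∀ u v, ⟪G z (S u), v⟫ = ⟪G z (S v), u⟫ := by
    intro u v
    simp only [hS, map_add, inner_add_left, hDW, map_neg, inner_neg_left, hG.apply_invMetric hz,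
      hG.apply_gam hz]
    rw [hG.fderiv_symm hz v u W, hG.fderiv_symm hz u v W, hG.fderiv_symm hz W v u]
    ring
  have hsum : ∑ j, ⟪A z (b j), S (b j)⟫ = 0 := by
    have : ∀ i, ⟪A z (b i), S (b i)⟫ = ∑ j, ⟪A z (b i), b j⟫ * ⟪G z (S (b i)), b j⟫ := fun i => by
      rw [hb, hG.invMetric_symm hz, hG.invMetric_apply hz, real_inner_comm]
    simp only [this]
    exact sum_sum_antisymm_mul_symm (fun i j => hanti z hz _ _) fun i j => hSsymm _ _
  rw [← neg_eq_zero, ← hsum, ← Finset.sum_neg_distrib]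
  refine Finset.sum_congr rfl fun j _ => ?_
  have h1 : G z (-invMetric G z (A z W)) = -(A z W) := by rw [map_neg, hG.apply_invMetric hz]
  simp only [hterm, hW.symm, h1, inner_neg_left, inner_add_left, hS, inner_add_right]
  rw [hAanti (b j) W (b j), hanti z hz W (gam G z (b j) (b j)),
    hanti z hz (fderiv ℝ (fun y => invMetric G y w) z (b j)) (b j)]
  ring

end IsMetricOn

end LocalGeometry

/-! ### The identity δδ = 0 in coordinates and the resulting elliptic equation. -/

section DoubleDivergence

set_option linter.unusedSectionVars false

open Topology Filter

local notation "⟪" x ", " y "⟫" => inner ℝ x y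

variable {E : Type*} [NormedAddCommGroup E] [InnerProductSpace ℝ E] [FiniteDimensional ℝ E]
  {ι : Type*} [Fintype ι] (e : OrthonormalBasis ι ℝ E)
  {G : E → E →L[ℝ] E} {U : Set E} {z : E}

/-- The double divergence of an antisymmetric bivector vanishes, if the divergence is twisted by
a closed form. -/
lemma sum_divergence_antisymm (e : ι → E) {t : ι → E → ℝ} {β : ι → ι → E → ℝ}
    (ht : ∀ k, DifferentiableAt ℝ (t k) z) (hβ : ∀ k j, ContDiffAt ℝ 2 (β k j) z)
    (hanti : ∀ k j, β k j =ᶠ[𝓝 z] fun y => -β j k y)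
    (hclosed : ∀ j k, fderiv ℝ (t k) z (e j) = fderiv ℝ (t j) z (e k)) :
    ∑ j, (fderiv ℝ (fun y => ∑ k, (fderiv ℝ (β k j) y (e k) + t k y * β k j y)) z (e j)
      + t j z * ∑ k, (fderiv ℝ (β k j) z (e k) + t k z * β k j z)) = 0 := by
  have hβd : ∀ k j, DifferentiableAt ℝ (β k j) z := fun k j => (hβ k j).differentiableAt (by simp)
  have hβ' : ∀ k j, DifferentiableAt ℝ (fun y => fderiv ℝ (β k j) y (e k)) z := fun k j =>
    (((hβ k j).fderiv_right (m := 1) (by norm_num)).clm_apply contDiffAt_const).differentiableAt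
      (by simp)
  have hexp : ∀ j, fderiv ℝ (fun y => ∑ k, (fderiv ℝ (β k j) y (e k) + t k y * β k j y)) z (e j)
      = ∑ k, (secondDeriv (β k j) z (e j) (e k) + (t k z * fderiv ℝ (β k j) z (e j)
        + β k j z * fderiv ℝ (t k) z (e j))) := by
    intro j
    have h : ∀ k ∈ Finset.univ, HasFDerivAt
        (fun y => fderiv ℝ (β k j) y (e k) + t k y * β k j y)
        (fderiv ℝ (fun y => fderiv ℝ (β k j) y (e k)) z
          + (t k z • fderiv ℝ (β k j) z + β k j z • fderiv ℝ (t k) z)) z := fun k _ =>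
      (hβ' k j).hasFDerivAt.add ((ht k).hasFDerivAt.mul (hβd k j).hasFDerivAt)
    rw [(HasFDerivAt.fun_sum h).fderiv]
    simp [secondDeriv]
  simp only [hexp, Finset.mul_sum, ← Finset.sum_add_distrib]
  have h1 : ∀ k j, β k j z = -β j k z := fun k j => (hanti k j).self_of_nhds
  have h2 : ∀ k j, fderiv ℝ (β k j) z = -fderiv ℝ (β j k) z := fun k j => by
    rw [(hanti k j).fderiv_eq, fderiv_fun_neg]
  have h3 : ∀ k j, secondDeriv (β k j) z (e j) (e k) = -secondDeriv (β j k) z (e k) (e j) := by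
    intro k j
    rw [secondDeriv_bilin (hβ k j), secondDeriv_bilin (hβ j k)]
    have : fderiv ℝ (β k j) =ᶠ[𝓝 z] fun y => -fderiv ℝ (β j k) y := by
      filter_upwards [(hanti k j).eventuallyEq_nhds] with y hy
      rw [hy.fderiv_eq, fderiv_fun_neg]
    rw [this.fderiv_eq, fderiv_fun_neg]
    have hs := (hβ j k).isSymmSndFDerivAt (by simp)
    change -(fderiv ℝ (fderiv ℝ (β j k)) z (e j) (e k)) = _
    rw [hs.eq]
  -- The full summand is antisymmetric in j and k: symmetry of second derivatives handles the
  -- leading term, closedness the derivative of t, and the other terms are symmetrized products with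
  -- β. It is then paired with the constant 1.
  refine Eq.trans ?_ (sum_sum_antisymm_mul_symm (p := fun j k => secondDeriv (β k j) z (e j) (e k)
    + (t k z * fderiv ℝ (β k j) z (e j) + β k j z * fderiv ℝ (t k) z (e j))
    + t j z * (fderiv ℝ (β k j) z (e k) + t k z * β k j z)) (q := fun _ _ => 1) ?_
    fun _ _ => rfl)
  · simp only [mul_one]
  · intro j k
    have h2' : ∀ u, fderiv ℝ (β k j) z u = -(fderiv ℝ (β j k) z u) := fun u => by rw [h2 k j]; rfl
    rw [h3 k j, h1 k j, h2', h2', hclosed j k]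
    ring

namespace IsMetricOn

lemma coordDiv_eq_sum_fderiv {Y : E → E} (hY : DifferentiableAt ℝ Y z) :
    coordDiv G Y z = ∑ k, (fderiv ℝ (fun y => ⟪Y y, e k⟫) z (e k)
      + theta G z (e k) * ⟪Y z, e k⟫) := by
  have h : ∀ k, fderiv ℝ (fun y => ⟪Y y, e k⟫) z (e k) = ⟪fderiv ℝ Y z (e k), e k⟫ := fun k => by
    rw [(hY.hasFDerivAt.inner ℝ (hasFDerivAt_const (e k) z)).fderiv]
    simp
  rw [coordDiv, trc_apply e, theta_eq_sum e, Finset.sum_add_distrib]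
  simp only [h]

/-- The divergences of the columns B eⱼ are the components of the divergence of the bivector B, so
this is δδ = 0; `theta` is the closed form that twists the divergence. -/
lemma sum_fderiv_coordDiv_antisymm (hG : IsMetricOn G U) (hz : z ∈ U) {B : E → E →L[ℝ] E}
    (hB : ContDiffOn ℝ ∞ B U) (hanti : ∀ y ∈ U, ∀ u v, ⟪B y u, v⟫ = -⟪B y v, u⟫) :
    ∑ j, (fderiv ℝ (fun y => coordDiv G (fun x => B x (e j)) y) z (e j)
      + theta G z (e j) * coordDiv G (fun x => B x (e j)) z) = 0 := by
  have hBat : ∀ y ∈ U, ContDiffAt ℝ ∞ B y := fun y hy => hB.contDiffAt (hG.isOpen.mem_nhds hy)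
  have hBe : ∀ y ∈ U, ∀ j, ContDiffAt ℝ ∞ (fun x => B x (e j)) y := fun y hy j =>
    (hBat y hy).clm_apply contDiffAt_const
  have hev : ∀ j, (fun y => coordDiv G (fun x => B x (e j)) y) =ᶠ[𝓝 z]
      fun y => ∑ k, (fderiv ℝ (fun y => ⟪B y (e j), e k⟫) y (e k)
        + theta G y (e k) * ⟪B y (e j), e k⟫) := fun j => by
    filter_upwards [hG.eventually_mem hz] with y hy
    exact coordDiv_eq_sum_fderiv e ((hBe y hy j).differentiableAt (by simp))
  rw [← sum_divergence_antisymm (z := z) e (t := fun k y => theta G y (e k))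
    (β := fun k j y => ⟪B y (e j), e k⟫)]
  · refine Finset.sum_congr rfl fun j _ => ?_
    have h0 : coordDiv G (fun x => B x (e j)) z = _ := (hev j).self_of_nhds
    rw [(hev j).fderiv_eq, h0]
  · exact fun k => (hG.contDiffAt_theta hz (e k)).differentiableAt (by simp)
  · exact fun k j => ((hBe z hz j).of_le (by norm_cast)).inner ℝ contDiffAt_const
  · intro k j
    filter_upwards [hG.eventually_mem hz] with y hy using hanti y hy _ _
  · exact fun j k => hG.fderiv_theta_symm hz _ _

/-- A function whose differential is the divergence of a `2`-form solves an elliptic equation. -/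
lemma sum_secondDeriv_eq_zero (hG : IsMetricOn G U) (hz : z ∈ U) {B : E → E →L[ℝ] E}
    (hB : ContDiffOn ℝ ∞ B U) (hanti : ∀ y ∈ U, ∀ u v, ⟪B y u, v⟫ = -⟪B y v, u⟫) {f : E → ℝ}
    (hf : ContDiffOn ℝ ∞ f U)
    (hfB : ∀ y ∈ U, ∀ w, fderiv ℝ f y (invMetric G y w) = coordDiv G (fun x => B x w) y) :
    ∑ j, ∑ m, ⟪invMetric G z (e j), e m⟫ * secondDeriv f z (e j) (e m)
      + ∑ m, (∑ j, (⟪fderiv ℝ (invMetric G) z (e j) (e j), e m⟫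
        + theta G z (e j) * ⟪invMetric G z (e j), e m⟫)) * fderiv ℝ f z (e m) = 0 := by
  have hfz : ContDiffAt ℝ ∞ f z := hf.contDiffAt (hG.isOpen.mem_nhds hz)
  have hfd : DifferentiableAt ℝ (fderiv ℝ f) z :=
    (hfz.fderiv_right (m := 1) (by norm_cast)).differentiableAt (by simp)
  have hHd : DifferentiableAt ℝ (invMetric G) z :=
    (hG.contDiffAt_invMetric hz).differentiableAt (by simp)
  have hexp : ∀ v : E, v = ∑ m, ⟪v, e m⟫ • e m := fun v => by
    conv_lhs => rw [← e.sum_repr' v]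
    simp only [real_inner_comm]
  have hlin : ∀ (L : E →L[ℝ] ℝ) (v : E), L v = ∑ m, ⟪v, e m⟫ * L (e m) := fun L v => by
    conv_lhs => rw [hexp v]
    simp
  -- By hypothesis the divergence of B eⱼ is df(G⁻¹eⱼ), so the vanishing double divergence is the
  -- Laplace–Beltrami operator of f in divergence form. The product rule brings out the second-order
  -- coefficients G⁻¹.
  have hX : ∀ j, fderiv ℝ (fun y => coordDiv G (fun x => B x (e j)) y) z (e j)
      = fderiv ℝ (fderiv ℝ f) z (e j) (invMetric G z (e j))
        + fderiv ℝ f z (fderiv ℝ (invMetric G) z (e j) (e j)) := fun j => by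
    have : (fun y => coordDiv G (fun x => B x (e j)) y) =ᶠ[𝓝 z]
        fun y => fderiv ℝ f y (invMetric G y (e j)) := by
      filter_upwards [hG.eventually_mem hz] with y hy using (hfB y hy _).symm
    rw [this.fderiv_eq, (hfd.hasFDerivAt.clm_apply
      (hHd.hasFDerivAt.clm_apply (hasFDerivAt_const (e j) z))).fderiv]
    simp [add_comm]
  have key := hG.sum_fderiv_coordDiv_antisymm e hz hB hanti
  simp only [hX, ← hfB z hz] at key
  rw [← key]
  simp only [Finset.sum_mul]
  rw [Finset.sum_comm (s := Finset.univ) (t := Finset.univ)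
    (f := fun m j => (⟪fderiv ℝ (invMetric G) z (e j) (e j), e m⟫
        + theta G z (e j) * ⟪invMetric G z (e j), e m⟫) * fderiv ℝ f z (e m)),
    ← Finset.sum_add_distrib]
  refine Finset.sum_congr rfl fun j _ => ?_
  rw [hlin (fderiv ℝ (fderiv ℝ f) z (e j)), hlin _ (fderiv ℝ (invMetric G) z (e j) (e j)),
    hlin (fderiv ℝ f z) (invMetric G z (e j))]
  simp only [secondDeriv_bilin (hfz.of_le (m := 2) (by norm_cast)), add_mul, Finset.mul_sum,
    Finset.sum_add_distrib, add_assoc, mul_assoc]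

end IsMetricOn

end DoubleDivergence

/-! ### The maximum principle applied to the coordinate equation. -/

section StrongMaximum

open Topology

variable {n : ℕ}

local notation "𝔼" => EuclideanSpace ℝ (Fin n)

/-- Strong maximum principle for functions whose differential is the divergence of a `2`-form. -/
theorem IsMetricOn.eventually_eq_of_isMax {G : 𝔼 → 𝔼 →L[ℝ] 𝔼} {U : Set 𝔼} (hG : IsMetricOn G U)
    {A : 𝔼 → 𝔼 →L[ℝ] 𝔼} (hA : ContDiffOn ℝ ∞ A U)
    (hanti : ∀ y ∈ U, ∀ u v, inner ℝ (A y u) v = -inner ℝ (A y v) u) {f : 𝔼 → ℝ}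
    (hf : ContDiffOn ℝ ∞ f U)
    (hfA : ∀ y ∈ U, ∀ w, fderiv ℝ f y (invMetric G y w) =
      coordDiv G (fun x => -invMetric G x (A x (invMetric G x w))) y)
    {m : ℝ} (hm : ∀ z ∈ U, f z ≤ m) {z₀ : 𝔼} (hz₀ : z₀ ∈ U) (hfz₀ : f z₀ = m) :
    ∀ᶠ z in 𝓝 z₀, f z = m := by
  set e := EuclideanSpace.basisFun (Fin n) ℝ
  have he : ∀ k, e k = stdVec k := fun k => EuclideanSpace.basisFun_apply _ _ _
  have hH : ContDiffOn ℝ ∞ (invMetric G) U := fun z hz =>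
    (hG.contDiffAt_invMetric hz).contDiffWithinAt
  have hHd : ∀ j, ContinuousOn (fun z => fderiv ℝ (invMetric G) z (e j) (e j)) U := fun j =>
    (((hH.continuousOn_fderiv_of_isOpen hG.isOpen (by simp)).clm_apply continuousOn_const).clm_apply
      continuousOn_const)
  have hθ : ∀ j, ContinuousOn (fun z => theta G z (e j)) U := fun j z hz =>
    (hG.contDiffAt_theta hz (e j)).continuousAt.continuousWithinAt
  have ha : ∀ i j, ContinuousOn (fun z => inner ℝ (invMetric G z (e i)) (e j)) U := fun i j =>
    (hH.continuousOn.clm_apply continuousOn_const).inner continuousOn_const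
  refine eventually_eq_of_diffOp_eq_zero hG.isOpen
    (a := fun z i j => inner ℝ (invMetric G z (e i)) (e j))
    (b := fun z m => ∑ j, (inner ℝ (fderiv ℝ (invMetric G) z (e j) (e j)) (e m)
      + theta G z (e j) * inner ℝ (invMetric G z (e j)) (e m))) ha ?_ ?_ (hf.of_le (by norm_cast))
    ?_ hm hz₀ hfz₀
  · intro m
    exact continuousOn_finsetSum _ fun j _ =>
      ((hHd j).inner continuousOn_const).add ((hθ j).mul (ha j m))
  · intro z hz
    refine Matrix.PosDef.of_dotProduct_mulVec_pos ?_ ?_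
    · exact Matrix.IsHermitian.ext fun i j => hG.invMetric_symm hz (e j) (e i)
    · intro x hx
      set u : 𝔼 := ∑ i, x i • e i with hu
      have hu0 : u ≠ 0 := by
        intro h
        refine hx (funext fun i => ?_)
        have : inner ℝ (e i) u = x i := by rw [hu]; exact e.orthonormal.inner_right_fintype x i
        rw [← this, h, inner_zero_right]; rfl
      have := hG.invMetric_pos hz hu0
      rw [hu] at this
      simp only [map_sum, map_smul, sum_inner, inner_sum, inner_smul_left, inner_smul_right,
        conj_trivial] at this
      simp only [dotProduct, Matrix.mulVec, Pi.star_apply, star_trivial, Finset.mul_sum]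
      rw [Finset.sum_comm]
      simp only [Finset.mul_sum] at this
      exact this.trans_eq (Finset.sum_congr rfl fun i _ => Finset.sum_congr rfl fun j _ => by ring)
  · intro z hz
    -- The bivector is, up to sign, A with both indices raised, so it inherits antisymmetry from A.
    have hB : ContDiffOn ℝ ∞ (fun x => -(invMetric G x * A x * invMetric G x)) U :=
      ((hH.mul hA).mul hH).neg
    have := hG.sum_secondDeriv_eq_zero e hz hB (fun y hy u v => ?_) hf (fun y hy w => hfA y hy w)
    · simpa only [diffOp, he] using this
    · have h1 : ∀ p q, inner ℝ (invMetric G y (A y (invMetric G y p))) q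
          = inner ℝ (A y (invMetric G y p)) (invMetric G y q) := fun p q => by
        rw [hG.invMetric_symm hy, real_inner_comm]
      change inner ℝ (-(invMetric G y (A y (invMetric G y u)))) v
        = -inner ℝ (-(invMetric G y (A y (invMetric G y v)))) u
      rw [inner_neg_left, inner_neg_left, h1, h1, hanti y hy]

end StrongMaximum

/-! ### Local parametrizations of the manifold, components of vector fields, Lie bracket. -/

section Parametrization

open Topology Filter VectorField

variable {n : ℕ} {M : Type*} [TopologicalSpace M] [ChartedSpace (EuclideanSpace ℝ (Fin n)) M]

local notation "𝔼" => EuclideanSpace ℝ (Fin n)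

variable (n) in
/-- The local parametrization of `M` inverse to the preferred chart at `p`. -/
noncomputable def par (p : M) : 𝔼 → M := (extChartAt (𝓡 n) p).symm

variable (n) in
/-- The domain of the local parametrization at `p`. -/
def dom (p : M) : Set 𝔼 := (extChartAt (𝓡 n) p).target

/-- The differential of the local parametrization. -/
noncomputable def dpar (p : M) (z : 𝔼) : 𝔼 →L[ℝ] TangentSpace (𝓡 n) (par n p z) :=
  mfderiv 𝓘(ℝ, 𝔼) (𝓡 n) (par n p) z

/-- The components of a vector field in the local parametrization. -/
noncomputable def rep (p : M) (X : VField n M) (z : 𝔼) : 𝔼 :=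
  (dpar p z).inverse (X (par n p z))

variable (n) in
lemma isOpen_dom (p : M) : IsOpen (dom n p) := isOpen_extChartAt_target p

variable (n) in
lemma exists_par_eq (p : M) : ∃ z ∈ dom n p, par n p z = p :=
  ⟨extChartAt (𝓡 n) p p, mem_extChartAt_target p, extChartAt_to_inv p⟩

variable {p : M} {z : EuclideanSpace ℝ (Fin n)}

lemma par_mem_source (hz : z ∈ dom n p) : par n p z ∈ (extChartAt (𝓡 n) p).source :=
  (extChartAt (𝓡 n) p).map_target hz

/-- Transfers statements holding near z in coordinates to neighbourhoods in M; the chart is a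
continuous inverse. -/
lemma par_image_mem_nhds (hz : z ∈ dom n p) {s : Set 𝔼} (hs : s ∈ 𝓝 z) :
    par n p '' s ∈ 𝓝 (par n p z) := by
  have h : ContinuousAt (extChartAt (𝓡 n) p) (par n p z) :=
    continuousAt_extChartAt' (par_mem_source hz)
  have hr : extChartAt (𝓡 n) p (par n p z) = z := (extChartAt (𝓡 n) p).right_inv hz
  have h1 : (extChartAt (𝓡 n) p) ⁻¹' s ∈ 𝓝 (par n p z) := h (by rw [hr]; exact hs)
  filter_upwards [h1, extChartAt_source_mem_nhds' (par_mem_source hz)] with y hy hys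
  exact ⟨_, hy, (extChartAt (𝓡 n) p).left_inv hys⟩

section Manifold

variable [IsManifold (𝓡 n) ∞ M]

variable (n) in
lemma contMDiffOn_par (p : M) : ContMDiffOn 𝓘(ℝ, 𝔼) (𝓡 n) ∞ (par n p) (dom n p) :=
  contMDiffOn_extChartAt_symm p

lemma contMDiffAt_par (hz : z ∈ dom n p) : ContMDiffAt 𝓘(ℝ, 𝔼) (𝓡 n) ∞ (par n p) z :=
  (contMDiffOn_par n p).contMDiffAt ((isOpen_dom n p).mem_nhds hz)

lemma isInvertible_dpar (hz : z ∈ dom n p) : (dpar p z).IsInvertible := by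
  have := isInvertible_mfderivWithin_extChartAt_symm (I := 𝓡 n) hz
  rwa [ModelWithCorners.range_eq_univ, mfderivWithin_univ] at this

lemma dpar_rep (hz : z ∈ dom n p) (X : VField n M) : dpar p z (rep p X z) = X (par n p z) := by
  obtain ⟨e, he⟩ := isInvertible_dpar hz
  rw [rep, ← he]
  simp

lemma inverse_dpar_apply (hz : z ∈ dom n p) (u : 𝔼) : (dpar p z).inverse (dpar p z u) = u := by
  obtain ⟨e, he⟩ := isInvertible_dpar hz
  rw [← he]
  simp

lemma dpar_inverse_apply (hz : z ∈ dom n p) (v : TangentSpace (𝓡 n) (par n p z)) :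
    dpar p z ((dpar p z).inverse v) = v := by
  obtain ⟨e, he⟩ := isInvertible_dpar hz
  rw [← he]
  simp

lemma mdifferentiableAt_of_comp_par {f : M → ℝ} (hz : z ∈ dom n p)
    (hf : DifferentiableAt ℝ (f ∘ par n p) z) : MDifferentiableAt (𝓡 n) 𝓘(ℝ, ℝ) f (par n p z) := by
  have h1 : MDifferentiableAt (𝓡 n) 𝓘(ℝ, 𝔼) (extChartAt (𝓡 n) p) (par n p z) :=
    mdifferentiableAt_extChartAt (by simpa using par_mem_source hz)
  have hr : extChartAt (𝓡 n) p (par n p z) = z := (extChartAt (𝓡 n) p).right_inv hz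
  have h2 : MDifferentiableAt (𝓡 n) 𝓘(ℝ, ℝ) ((f ∘ par n p) ∘ extChartAt (𝓡 n) p) (par n p z) :=
    MDifferentiableAt.comp _ (by rw [hr]; exact hf.mdifferentiableAt) h1
  refine h2.congr_of_eventuallyEq ?_
  filter_upwards [extChartAt_source_mem_nhds' (par_mem_source hz)] with y hy
  exact congrArg f ((extChartAt (𝓡 n) p).left_inv hy).symm

lemma mdifferentiableAt_par (hz : z ∈ dom n p) : MDifferentiableAt 𝓘(ℝ, 𝔼) (𝓡 n) (par n p) z :=
  (contMDiffAt_par hz).mdifferentiableAt (by simp)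

/-- The differential of a function in coordinates. -/
lemma diff_dpar (hz : z ∈ dom n p) (f : M → ℝ) (u : 𝔼) :
    diff f (par n p z) (dpar p z u) = fderiv ℝ (f ∘ par n p) z u := by
  -- Differentiability of f and of its coordinate expression are equivalent, and where it fails both
  -- differentials are zero by convention. The formula therefore holds for every f.
  by_cases hf : MDifferentiableAt (𝓡 n) 𝓘(ℝ, ℝ) f (par n p z)
  · have h := mfderiv_comp_apply z hf (mdifferentiableAt_par hz) u
    rw [mfderiv_eq_fderiv] at h
    exact h.symm
  · have h2 : ¬ DifferentiableAt ℝ (f ∘ par n p) z :=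
    fun h => hf (mdifferentiableAt_of_comp_par hz h)
    rw [fderiv_zero_of_not_differentiableAt h2]
    have : mvfderiv (𝓡 n) f (par n p z) = 0 := by
      rw [mvfderiv, mfderiv_zero_of_not_mdifferentiableAt hf]; ext; simp
    rw [diff, this]; rfl

lemma differentiableAt_rep (hz : z ∈ dom n p) {X : VField n M}
    (hX : MDifferentiableAt (𝓡 n) (𝓡 n).tangent (fun x => (⟨x, X x⟩ : TangentBundle (𝓡 n) M))
      (par n p z)) : DifferentiableAt ℝ (rep p X) z := by
  have h : MDifferentiableAt 𝓘(ℝ, 𝔼) 𝓘(ℝ, 𝔼).tangent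
      (fun y => (⟨y, mpullback 𝓘(ℝ, 𝔼) (𝓡 n) (par n p) X y⟩ : TangentBundle 𝓘(ℝ, 𝔼) 𝔼)) z :=
    MDifferentiableAt.mpullback_vectorField hX ((contMDiffAt_par hz).of_le (m := 2) (by norm_cast))
      (isInvertible_dpar hz) le_rfl
  exact ((contMDiff_snd_tangentBundle_modelSpace 𝔼 𝓘(ℝ, 𝔼)).contMDiffAt.mdifferentiableAt
    one_ne_zero |>.comp z h).differentiableAt

lemma contDiffOn_rep {X : VField n M} (hX : IsSmooth X) : ContDiffOn ℝ ∞ (rep p X) (dom n p) := by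
  intro z hz
  have h := ContMDiffAt.mpullback_vectorField_preimage (m := ∞) (n := ∞) (hX (par n p z))
    (contMDiffAt_par hz) (isInvertible_dpar hz) (by simp)
  exact (contMDiffAt_vectorSpace_iff_contDiffAt.1 h).contDiffWithinAt

/-- The Lie bracket in coordinates. -/
lemma bracket_eq_dpar (hz : z ∈ dom n p) {X Y : VField n M}
    (hX : MDifferentiableAt (𝓡 n) (𝓡 n).tangent (fun x => (⟨x, X x⟩ : TangentBundle (𝓡 n) M))
      (par n p z))
    (hY : MDifferentiableAt (𝓡 n) (𝓡 n).tangent (fun x => (⟨x, Y x⟩ : TangentBundle (𝓡 n) M))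
      (par n p z)) :
    bracket X Y (par n p z)
      = dpar p z (fderiv ℝ (rep p Y) z (rep p X z) - fderiv ℝ (rep p X) z (rep p Y z)) := by
  have : IsManifold (𝓡 n) (minSmoothness ℝ 2) M :=
    by simpa using inferInstanceAs (IsManifold (𝓡 n) 2 M)
  -- The bracket is natural under pullback by the parametrization, and on the model space it is
  -- DY(X) - DX(Y).
  have h := mpullback_mlieBracket (n := 2) hX hY
    ((contMDiffAt_par hz).of_le (by norm_cast)) (by simp)
  rw [← dpar_inverse_apply hz (bracket X Y (par n p z))]
  congr 1
  refine h.trans ?_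
  rw [← mlieBracketWithin_univ, mlieBracketWithin_eq_lieBracketWithin]
  exact congrFun (lieBracketWithin_univ (𝕜 := ℝ) (V := rep p X) (W := rep p Y)) z

lemma mdifferentiableAt_ext {x : M} (v : TangentSpace (𝓡 n) x) :
    MDifferentiableAt (𝓡 n) (𝓡 n).tangent (fun y => (⟨y, ext v y⟩ : TangentBundle (𝓡 n) M)) x :=
  FiberBundle.mdifferentiableAt_extend (𝓡 n) 𝔼 v

lemma ext_self {x : M} (v : TangentSpace (𝓡 n) x) : ext v x = v :=
  FiberBundle.extend_apply_self 𝔼 v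

lemma rep_ext (hz : z ∈ dom n p) (u : 𝔼) : rep p (ext (dpar p z u)) z = u := by
  rw [rep, ext_self, inverse_dpar_apply hz]

lemma differentiableAt_rep_ext (hz : z ∈ dom n p) (v : TangentSpace (𝓡 n) (par n p z)) :
    DifferentiableAt ℝ (rep p (ext v)) z := differentiableAt_rep hz (mdifferentiableAt_ext v)

/-- Coordinate vector fields are smooth. -/
lemma contMDiffOn_dpar (p : M) (u : 𝔼) : ContMDiffOn 𝓘(ℝ, 𝔼) (𝓡 n).tangent ∞
    (fun z => (⟨par n p z, dpar p z u⟩ : TangentBundle (𝓡 n) M)) (dom n p) := by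
  have h := (contMDiffOn_par n p).contMDiffOn_tangentMapWithin (m := ∞) (by simp)
    (isOpen_dom n p).uniqueMDiffOn
  have hu : ContMDiff 𝓘(ℝ, 𝔼) 𝓘(ℝ, 𝔼).tangent ∞
      (fun z : 𝔼 => (⟨z, u⟩ : TangentBundle 𝓘(ℝ, 𝔼) 𝔼)) := fun z =>
    contMDiffAt_vectorSpace_iff_contDiffAt.2 contDiffAt_const
  refine (h.comp hu.contMDiffOn (fun z hz => hz)).congr fun z hz => ?_
  simp only [Function.comp, tangentMapWithin]
  rw [mfderivWithin_of_isOpen (isOpen_dom n p) hz]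
  rfl

end Manifold

end Parametrization

/-! ### The metric in a local parametrization. -/

section Coordinates

set_option linter.unusedSectionVars false

open Topology Filter

variable {n : ℕ} {M : Type*} [TopologicalSpace M] [ChartedSpace (EuclideanSpace ℝ (Fin n)) M]
  [IsManifold (𝓡 n) ∞ M] [Bundle.RiemannianBundle (fun x : M => TangentSpace (𝓡 n) x)]

local notation "𝔼" => EuclideanSpace ℝ (Fin n)

local notation "⟪" x ", " y "⟫" => inner ℝ x y

lemma g_comm (x : M) (v w : TangentSpace (𝓡 n) x) : g x v w = g x w v := real_inner_comm _ _

/-- `dualVec` represents a functional with respect to the metric. -/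
lemma dualVec_eq {x : M} {a : TangentSpace (𝓡 n) x → ℝ} {v : TangentSpace (𝓡 n) x}
    (h : ∀ w, a w = g x v w) : dualVec x a = v := by
  simp only [dualVec, h, g]
  conv_rhs => rw [← (onb x).sum_repr' v]
  exact Finset.sum_congr rfl fun i _ => by rw [real_inner_comm]

lemma sharp_flat (X : VField n M) : sharp (flat X) = X :=
  funext fun _ => dualVec_eq fun _ => rfl

/-- The components of the metric in a local parametrization. -/
noncomputable def metricRep (p : M) (z : 𝔼) : 𝔼 →L[ℝ] 𝔼 :=
  ∑ k, ((innerSL ℝ (dpar p z (stdVec k))).comp (dpar p z)).smulRight (stdVec k)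

lemma sum_inner_stdVec_mul (u v : 𝔼) : ∑ k, ⟪u, stdVec k⟫ * ⟪v, stdVec k⟫ = ⟪u, v⟫ := by
  simp [PiLp.inner_apply, mul_comm]

lemma sum_inner_stdVec_smul (u : 𝔼) : ∑ k, ⟪u, stdVec k⟫ • stdVec k = u := by
  refine ext_inner_right ℝ fun v => ?_
  simp only [sum_inner, inner_smul_left, conj_trivial]
  rw [← sum_inner_stdVec_mul u v]
  exact Finset.sum_congr rfl fun k _ => by rw [real_inner_comm v]

lemma inner_metricRep (p : M) (z u v : 𝔼) :
    ⟪metricRep p z u, v⟫ = g (par n p z) (dpar p z u) (dpar p z v) := by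
  have h1 : metricRep p z u = ∑ k, g (par n p z) (dpar p z (stdVec k)) (dpar p z u) • stdVec k := by
    simp only [metricRep, _root_.sum_apply, ContinuousLinearMap.smulRight_apply,
      ContinuousLinearMap.comp_apply, innerSL_apply_apply]
    rfl
  rw [h1, sum_inner]
  conv_rhs => rw [← sum_inner_stdVec_smul v]
  simp only [g, map_sum, map_smul, inner_sum, inner_smul_left, inner_smul_right, conj_trivial]
  refine Finset.sum_congr rfl fun k _ => ?_
  rw [real_inner_comm (dpar p z u), real_inner_comm v]
  ring

section Smooth

variable [IsContMDiffRiemannianBundle (𝓡 n) ∞ (EuclideanSpace ℝ (Fin n))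
      (fun x : M => TangentSpace (𝓡 n) x)]

lemma contDiffOn_g_dpar (p : M) (u v : 𝔼) :
    ContDiffOn ℝ ∞ (fun z => g (par n p z) (dpar p z u) (dpar p z v)) (dom n p) :=
  contMDiffOn_iff_contDiffOn.1 (ContMDiffOn.inner_bundle (contMDiffOn_dpar p u)
    (contMDiffOn_dpar p v))

lemma isMetricOn_metricRep (p : M) : IsMetricOn (metricRep p) (dom n p) where
  isOpen := isOpen_dom n p
  contDiffOn := by
    refine contDiffOn_clm_apply.2 fun u => ?_
    have h1 : ∀ z, metricRep p z u
        = ∑ k, g (par n p z) (dpar p z u) (dpar p z (stdVec k)) • stdVec k := fun z => by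
      conv_lhs => rw [← sum_inner_stdVec_smul (metricRep p z u)]
      simp only [inner_metricRep]
    simp only [h1]
    exact ContDiffOn.sum fun k _ => (contDiffOn_g_dpar p u _).smul contDiffOn_const
  symm z _ u v := by rw [inner_metricRep, inner_metricRep, g_comm]
  pos z hz u hu := by
    rw [inner_metricRep]
    refine real_inner_self_pos.2 fun h => hu ?_
    rw [← inverse_dpar_apply hz u, h, map_zero]

end Smooth

end Coordinates

/-! ### Connection, divergence, codifferential and Laplacian in coordinates. -/

section Operators

set_option linter.unusedSectionVars false

open Topology Filter

variable {n : ℕ} {M : Type*} [TopologicalSpace M] [ChartedSpace (EuclideanSpace ℝ (Fin n)) M]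
  [IsManifold (𝓡 n) ∞ M] [Bundle.RiemannianBundle (fun x : M => TangentSpace (𝓡 n) x)]
  [IsContMDiffRiemannianBundle (𝓡 n) ∞ (EuclideanSpace ℝ (Fin n))
      (fun x : M => TangentSpace (𝓡 n) x)]
  {p : M} {z : EuclideanSpace ℝ (Fin n)}

local notation "𝔼" => EuclideanSpace ℝ (Fin n)

local notation "⟪" x ", " y "⟫" => inner ℝ x y

/-- The vector field is differentiable at `x`. -/
abbrev IsDiffAt (X : VField n M) (x : M) : Prop :=
  MDifferentiableAt (𝓡 n) (𝓡 n).tangent (fun y => (⟨y, X y⟩ : TangentBundle (𝓡 n) M)) x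

lemma eventually_mem_dom (hz : z ∈ dom n p) : ∀ᶠ y in 𝓝 z, y ∈ dom n p :=
  (isOpen_dom n p).mem_nhds hz

lemma diff_g_dpar (hz : z ∈ dom n p) {X Y : VField n M} (hX : IsDiffAt X (par n p z))
    (hY : IsDiffAt Y (par n p z)) (u : 𝔼) :
    diff (fun y => g y (X y) (Y y)) (par n p z) (dpar p z u) =
      ⟪fderiv ℝ (metricRep p) z u (rep p X z), rep p Y z⟫
      + ⟪metricRep p z (fderiv ℝ (rep p X) z u), rep p Y z⟫
      + ⟪metricRep p z (rep p X z), fderiv ℝ (rep p Y) z u⟫ := by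
  rw [diff_dpar hz]
  have hev : (fun y => g y (X y) (Y y)) ∘ par n p =ᶠ[𝓝 z]
      fun y => ⟪metricRep p y (rep p X y), rep p Y y⟫ := by
    filter_upwards [eventually_mem_dom hz] with y hy
    rw [inner_metricRep, dpar_rep hy, dpar_rep hy]; rfl
  rw [hev.fderiv_eq, ((((isMetricOn_metricRep (n := n) p).differentiableAt hz).hasFDerivAt.clm_apply
    (differentiableAt_rep hz hX).hasFDerivAt).inner ℝ
    (differentiableAt_rep hz hY).hasFDerivAt).fderiv]
  simp [inner_add_left]
  ring

lemma g_bracket_dpar (hz : z ∈ dom n p) {X Y Z : VField n M} (hX : IsDiffAt X (par n p z))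
    (hY : IsDiffAt Y (par n p z)) :
    g (par n p z) (bracket X Y (par n p z)) (Z (par n p z)) =
      ⟪metricRep p z (fderiv ℝ (rep p Y) z (rep p X z)), rep p Z z⟫
      - ⟪metricRep p z (fderiv ℝ (rep p X) z (rep p Y z)), rep p Z z⟫ := by
  rw [bracket_eq_dpar hz hX hY, ← dpar_rep hz Z, ← inner_metricRep, map_sub, inner_sub_left]

/-- All derivatives of components cancel except that of Y along X, and the derivatives of the metric
assemble into a Christoffel symbol. Differentiability is assumed at the single point only, which is
what `ext` is known to provide. -/
lemma koszul_dpar (hz : z ∈ dom n p) {X Y Z : VField n M} (hX : IsDiffAt X (par n p z))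
    (hY : IsDiffAt Y (par n p z)) (hZ : IsDiffAt Z (par n p z)) :
    koszul X Y Z (par n p z) =
      ⟪metricRep p z (fderiv ℝ (rep p Y) z (rep p X z)
        + gam (metricRep p) z (rep p X z) (rep p Y z)), rep p Z z⟫ := by
  have hG := isMetricOn_metricRep (n := n) p
  rw [koszul, g_bracket_dpar hz hX hY, g_bracket_dpar hz hX hZ, g_bracket_dpar hz hY hZ]
  rw [← dpar_rep hz X, ← dpar_rep hz Y, ← dpar_rep hz Z, diff_g_dpar hz hY hZ, diff_g_dpar hz hX hZ,
    diff_g_dpar hz hX hY, map_add, inner_add_left, hG.apply_gam hz]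
  rw [hG.symm z hz (rep p Y z) (fderiv ℝ (rep p Z) z (rep p X z)),
    hG.symm z hz (rep p X z) (fderiv ℝ (rep p Z) z (rep p Y z)),
    hG.symm z hz (rep p X z) (fderiv ℝ (rep p Y) z (rep p Z z))]
  ring

/-- The Levi-Civita connection in coordinates. -/
lemma nabla_dpar (hz : z ∈ dom n p) {X Y : VField n M} (hX : IsDiffAt X (par n p z))
    (hY : IsDiffAt Y (par n p z)) :
    nabla X Y (par n p z) = dpar p z (fderiv ℝ (rep p Y) z (rep p X z)
        + gam (metricRep p) z (rep p X z) (rep p Y z)) := by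
  refine dualVec_eq fun w => ?_
  rw [koszul_dpar hz hX hY (mdifferentiableAt_ext w), inner_metricRep, dpar_rep hz, ext_self]

/-- The covariant derivative of a `1`-form in coordinates. -/
lemma covOne_dpar (hz : z ∈ dom n p) {γ : OneForm n M} {a : 𝔼 → 𝔼}
    (ha : ∀ y ∈ dom n p, ∀ u, γ (par n p y) (dpar p y u) = ⟪a y, u⟫)
    (had : DifferentiableAt ℝ a z) (u v : 𝔼) :
    covOne γ (par n p z) (dpar p z u) (dpar p z v)
      = ⟪fderiv ℝ a z u, v⟫ - ⟪a z, gam (metricRep p) z u v⟫ := by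
  rw [covOne, diff_dpar hz, nabla_dpar hz (mdifferentiableAt_ext _) (mdifferentiableAt_ext _),
    ha z hz, rep_ext hz, rep_ext hz]
  -- The derivative of the chosen extension appears here and again in `nabla`, and cancels; hence
  -- the result does not depend on the choice.
  have hev : (fun y => γ y (ext (dpar p z v) y)) ∘ par n p =ᶠ[𝓝 z]
      fun y => ⟪a y, rep p (ext (dpar p z v)) y⟫ := by
    filter_upwards [eventually_mem_dom hz] with y hy
    rw [← ha y hy, dpar_rep hy]; rfl
  rw [hev.fderiv_eq, (had.hasFDerivAt.inner ℝ
    (differentiableAt_rep_ext hz (dpar p z v)).hasFDerivAt).fderiv]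
  simp [inner_add_right, rep_ext hz]

/-- The exterior derivative of a `1`-form in coordinates. -/
lemma extDeriv_dpar (hz : z ∈ dom n p) {γ : OneForm n M} {a : 𝔼 → 𝔼}
    (ha : ∀ y ∈ dom n p, ∀ u, γ (par n p y) (dpar p y u) = ⟪a y, u⟫)
    (had : DifferentiableAt ℝ a z) (u v : 𝔼) :
    extDeriv γ (par n p z) (dpar p z u) (dpar p z v)
      = ⟪fderiv ℝ a z u, v⟫ - ⟪fderiv ℝ a z v, u⟫ := by
  have hev : ∀ w, (fun y => γ y (ext (dpar p z w) y)) ∘ par n p =ᶠ[𝓝 z]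
      fun y => ⟪a y, rep p (ext (dpar p z w)) y⟫ := fun w => by
    filter_upwards [eventually_mem_dom hz] with y hy
    rw [← ha y hy, dpar_rep hy]; rfl
  have hd : ∀ w u, fderiv ℝ ((fun y => γ y (ext (dpar p z w) y)) ∘ par n p) z u
      = ⟪a z, fderiv ℝ (rep p (ext (dpar p z w))) z u⟫ + ⟪fderiv ℝ a z u, w⟫ := fun w u => by
    rw [(hev w).fderiv_eq, (had.hasFDerivAt.inner ℝ
      (differentiableAt_rep_ext hz (dpar p z w)).hasFDerivAt).fderiv]
    simp [rep_ext hz]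
  rw [extDeriv, diff_dpar hz, diff_dpar hz, hd, hd,
    bracket_eq_dpar hz (mdifferentiableAt_ext _) (mdifferentiableAt_ext _), ha z hz, rep_ext hz,
    rep_ext hz, inner_sub_right]
  ring

/-- The covariant derivative of a `(0,2)`-tensor in coordinates. -/
lemma covTwo_dpar (hz : z ∈ dom n p) {α : TwoTensor n M} {A : 𝔼 → 𝔼 →L[ℝ] 𝔼}
    (hA : ∀ y ∈ dom n p, ∀ u v, α (par n p y) (dpar p y u) (dpar p y v) = ⟪A y u, v⟫)
    (hAd : DifferentiableAt ℝ A z) (u v w : 𝔼) :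
    covTwo α (par n p z) (dpar p z u) (dpar p z v) (dpar p z w)
      = ⟪fderiv ℝ A z u v, w⟫ - ⟪A z (gam (metricRep p) z u v), w⟫
        - ⟪A z v, gam (metricRep p) z u w⟫ := by
  have hev : (fun y => α y (ext (dpar p z v) y) (ext (dpar p z w) y)) ∘ par n p =ᶠ[𝓝 z]
      fun y => ⟪A y (rep p (ext (dpar p z v)) y), rep p (ext (dpar p z w)) y⟫ := by
    filter_upwards [eventually_mem_dom hz] with y hy
    rw [← hA y hy, dpar_rep hy, dpar_rep hy]; rfl
  rw [covTwo, diff_dpar hz, hev.fderiv_eq, ((hAd.hasFDerivAt.clm_apply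
    (differentiableAt_rep_ext hz (dpar p z v)).hasFDerivAt).inner ℝ
    (differentiableAt_rep_ext hz (dpar p z w)).hasFDerivAt).fderiv,
    nabla_dpar hz (mdifferentiableAt_ext _) (mdifferentiableAt_ext _),
    nabla_dpar hz (mdifferentiableAt_ext _) (mdifferentiableAt_ext _), hA z hz, hA z hz,
    rep_ext hz, rep_ext hz, rep_ext hz]
  simp [inner_add_right, inner_add_left]
  ring

/-- The coordinates of the orthonormal basis at a point. -/
noncomputable def onbRep (p : M) (z : 𝔼)
    (i : Fin (Module.finrank ℝ (TangentSpace (𝓡 n) (par n p z)))) : 𝔼 :=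
  (dpar p z).inverse (onb (par n p z) i)

lemma dpar_onbRep (hz : z ∈ dom n p)
    (i : Fin (Module.finrank ℝ (TangentSpace (𝓡 n) (par n p z)))) :
    dpar p z (onbRep p z i) = onb (par n p z) i := dpar_inverse_apply hz _

/-- This is Parseval's identity in the tangent space, applied to the vectors dual to u and v. -/
lemma isFrameAt_onbRep (hz : z ∈ dom n p) : IsFrameAt (metricRep p) z (onbRep p z) := by
  intro u v
  have hG := isMetricOn_metricRep (n := n) p
  have h : ∀ u j, ⟪u, onbRep p z j⟫
      = inner ℝ (dpar p z (invMetric (metricRep p) z u)) (onb (par n p z) j) := fun u j => by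
    conv_lhs => rw [← hG.apply_invMetric hz u, inner_metricRep, dpar_onbRep hz]
    rfl
  simp only [h]
  have h2 := (onb (par n p z)).sum_inner_mul_inner (dpar p z (invMetric (metricRep p) z u))
    (dpar p z (invMetric (metricRep p) z v))
  simp only [real_inner_comm (dpar p z (invMetric (metricRep p) z v))] at h2 ⊢
  rw [h2]
  have h3 := inner_metricRep p z (invMetric (metricRep p) z u) (invMetric (metricRep p) z v)
  rw [hG.apply_invMetric hz, real_inner_comm, hG.invMetric_symm hz] at h3
  exact (real_inner_comm _ _).trans h3.symm

/-- The components of the metric dual of a vector field. -/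
lemma flat_dpar (hz : z ∈ dom n p) (ξ : VField n M) (u : 𝔼) :
    flat ξ (par n p z) (dpar p z u) = ⟪metricRep p z (rep p ξ z), u⟫ := by
  rw [inner_metricRep, dpar_rep hz]; rfl

/-- The divergence in coordinates. -/
lemma div_dpar (hz : z ∈ dom n p) {ξ : VField n M} (hξ : IsDiffAt ξ (par n p z)) :
    div ξ (par n p z) = coordDiv (metricRep p) (rep p ξ) z := by
  rw [(isMetricOn_metricRep (n := n) p).coordDiv_eq_sum hz (isFrameAt_onbRep hz), div, tr]
  refine Finset.sum_congr rfl fun i _ => ?_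
  rw [nabla_dpar hz (mdifferentiableAt_ext _) hξ, inner_metricRep, dpar_onbRep hz, onbRep]
  rw [show rep p (ext (onb (par n p z) i)) z = (dpar p z).inverse (onb (par n p z) i) by
    rw [rep, ext_self]]

/-- The codifferential of the metric dual of a vector field is minus the divergence. -/
lemma codiffOne_flat_dpar (hz : z ∈ dom n p) {ξ : VField n M} (hξ : IsDiffAt ξ (par n p z)) :
    codiffOne (flat ξ) (par n p z) = -coordDiv (metricRep p) (rep p ξ) z := by
  have hG := isMetricOn_metricRep (n := n) p
  have hrep := differentiableAt_rep hz hξ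
  rw [hG.coordDiv_eq_sum_dual hz (isFrameAt_onbRep hz) hrep, codiffOne, tr]
  congr 1
  refine Finset.sum_congr rfl fun i _ => ?_
  rw [← dpar_onbRep hz i, covOne_dpar hz (fun y hy u => flat_dpar hy ξ u)
    ((hG.differentiableAt hz).clm_apply hrep)]

lemma IsSmooth.isDiffAt {ξ : VField n M} (hξ : IsSmooth ξ) (x : M) : IsDiffAt ξ x :=
  (hξ x).mdifferentiableAt (by simp)

lemma codiffOne_flat {ξ : VField n M} (hξ : IsSmooth ξ) (x : M) :
    codiffOne (flat ξ) x = -div ξ x := by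
  obtain ⟨z, hz, hx⟩ := exists_par_eq n x
  rw [← hx, codiffOne_flat_dpar hz (hξ.isDiffAt _), div_dpar hz (hξ.isDiffAt _)]

lemma contDiffOn_coordDiv {ξ : VField n M} (hξ : IsSmooth ξ) (p : M) :
    ContDiffOn ℝ ∞ (coordDiv (metricRep p) (rep p ξ)) (dom n p) := by
  intro z hz
  have hG := isMetricOn_metricRep (n := n) p
  have hrep : ContDiffAt ℝ ∞ (rep p ξ) z :=
    (contDiffOn_rep hξ).contDiffAt ((isOpen_dom n p).mem_nhds hz)
  have h1 : ContDiffAt ℝ ∞ (fun y => trc (fderiv ℝ (rep p ξ) y)) z :=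
    (ContinuousLinearMap.contDiff (trc (E := EuclideanSpace ℝ (Fin n)))).contDiffAt.comp z
      (hrep.fderiv_right (m := ∞) (by simp))
  -- Smoothness of `theta` is known for a fixed argument, so the varying argument is expanded in the
  -- standard basis.
  have h2 : ContDiffAt ℝ ∞ (fun y => ∑ k, theta (metricRep p) y (EuclideanSpace.basisFun _ ℝ k)
      * ⟪rep p ξ y, EuclideanSpace.basisFun _ ℝ k⟫) z :=
    ContDiffAt.sum fun k _ => (hG.contDiffAt_theta hz _).mul (hrep.inner ℝ contDiffAt_const)
  simp only [← theta_eq_sum] at h2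
  exact (h1.add h2).contDiffWithinAt

lemma contDiffOn_div_comp_par {ξ : VField n M} (hξ : IsSmooth ξ) (p : M) :
    ContDiffOn ℝ ∞ (div ξ ∘ par n p) (dom n p) :=
  (contDiffOn_coordDiv hξ p).congr fun _ hy => div_dpar hy (hξ.isDiffAt _)

/-- The exterior derivative of a vector field, as a field of endomorphisms. -/
noncomputable def curlOp (a : 𝔼 → 𝔼) (z : 𝔼) : 𝔼 →L[ℝ] 𝔼 :=
  fderiv ℝ a z - ∑ k, (innerSL ℝ (fderiv ℝ a z (stdVec k))).smulRight (stdVec k)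

lemma curlOp_apply (a : 𝔼 → 𝔼) (z u : 𝔼) :
    curlOp a z u = fderiv ℝ a z u - ∑ k, ⟪fderiv ℝ a z (stdVec k), u⟫ • stdVec k := by
  simp [curlOp]

lemma inner_curlOp (a : 𝔼 → 𝔼) (z u v : 𝔼) :
    ⟪curlOp a z u, v⟫ = ⟪fderiv ℝ a z u, v⟫ - ⟪fderiv ℝ a z v, u⟫ := by
  rw [curlOp_apply, inner_sub_left]
  congr 1
  conv_rhs => rw [← sum_inner_stdVec_smul v]
  simp only [sum_inner, inner_smul_left, map_sum, map_smul, conj_trivial]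
  exact Finset.sum_congr rfl fun k _ => by rw [real_inner_comm v]; ring

lemma contDiffOn_curlOp {a : 𝔼 → 𝔼} {U : Set 𝔼} (hU : IsOpen U) (ha : ContDiffOn ℝ ∞ a U) :
    ContDiffOn ℝ ∞ (curlOp a) U := by
  have hd : ∀ u, ContDiffOn ℝ ∞ (fun z => fderiv ℝ a z u) U := fun u =>
    (ha.fderiv_of_isOpen hU (by simp)).clm_apply contDiffOn_const
  refine contDiffOn_clm_apply.2 fun u => ?_
  simp only [curlOp_apply]
  exact (hd u).sub (ContDiffOn.sum fun k _ =>
    ((hd _).inner ℝ contDiffOn_const).smul contDiffOn_const)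

/-- For a harmonic form, the differential of the divergence is the divergence of a `2`-form. -/
lemma fderiv_codiffOne_of_isHarmonic {ξ : VField n M} (hξ : IsSmooth ξ)
    (h : IsHarmonic (flat ξ)) (hz : z ∈ dom n p) (w : 𝔼) :
    fderiv ℝ (codiffOne (flat ξ) ∘ par n p) z (invMetric (metricRep p) z w) =
      coordDiv (metricRep p) (fun x => -invMetric (metricRep p) x
        (curlOp (fun y => metricRep p y (rep p ξ y)) x (invMetric (metricRep p) x w))) z := by
  have hG := isMetricOn_metricRep (n := n) p
  have ha : ContDiffOn ℝ ∞ (fun y => metricRep p y (rep p ξ y)) (dom n p) :=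
    hG.contDiffOn.clm_apply (contDiffOn_rep hξ)
  have hA := contDiffOn_curlOp (isOpen_dom n p) ha
  have hAz : DifferentiableAt ℝ (curlOp fun y => metricRep p y (rep p ξ y)) z :=
    (hA.contDiffAt ((isOpen_dom n p).mem_nhds hz)).differentiableAt (by simp)
  rw [← hG.sum_covDeriv_eq_coordDiv hz (isFrameAt_onbRep hz) hAz
    (fun y _ u v => by rw [inner_curlOp, inner_curlOp]; ring)]
  -- Harmonicity is evaluated on the vector dual to the constant form w; the sum just introduced is
  -- minus the codifferential of dη on that vector.
  have h1 := h (par n p z) (dpar p z (invMetric (metricRep p) z w))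
  rw [hodgeLaplacian, diff_dpar hz, codiffTwo, tr] at h1
  have h2 : ∀ y ∈ dom n p, ∀ u v, extDeriv (flat ξ) (par n p y) (dpar p y u) (dpar p y v)
      = ⟪curlOp (fun y => metricRep p y (rep p ξ y)) y u, v⟫ := fun y hy u v => by
    rw [inner_curlOp]
    exact extDeriv_dpar hy (fun y hy u => flat_dpar hy ξ u)
      ((ha.contDiffAt ((isOpen_dom n p).mem_nhds hy)).differentiableAt (by simp)) u v
  have h3 := fun i => covTwo_dpar hz h2 hAz (onbRep p z i) (onbRep p z i)
    (invMetric (metricRep p) z w)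
  simp only [dpar_onbRep hz] at h3
  simp only [h3] at h1
  linarith

/-- A function that is smooth in coordinates and has vanishing differential is constant. -/
lemma forall_diff_eq_zero_iff [ConnectedSpace M] {f : M → ℝ}
    (hf : ∀ p, ContDiffOn ℝ ∞ (f ∘ par n p) (dom n p)) :
    (∀ x w, diff (n := n) f x w = 0) ↔ ∃ c, ∀ x, f x = c := by
  refine ⟨fun h => ?_, fun ⟨c, hc⟩ x w => ?_⟩
  · have hloc : IsLocallyConstant f := by
      refine (IsLocallyConstant.iff_eventually_eq _).2 fun x => ?_
      obtain ⟨z, hz, hx⟩ := exists_par_eq n x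
      have hev : ∀ᶠ y in 𝓝 z, (f ∘ par n x) y = (f ∘ par n x) z := by
        obtain ⟨r, hr, hrd⟩ := Metric.isOpen_iff.1 (isOpen_dom n x) z hz
        filter_upwards [Metric.ball_mem_nhds z hr] with y hy
        refine (convex_ball z r).is_const_of_fderivWithin_eq_zero (𝕜 := ℝ)
          (((hf x).mono hrd).differentiableOn (by simp)) (fun y hy => ?_) hy
          (Metric.mem_ball_self hr)
        rw [fderivWithin_of_isOpen Metric.isOpen_ball hy]
        ext u
        rw [← diff_dpar (hrd hy), h]; rfl
      have hmem := par_image_mem_nhds hz hev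
      rw [hx] at hmem
      filter_upwards [hmem] with y hy
      obtain ⟨t, ht, rfl⟩ := hy
      exact ht.trans (congrArg f hx)
    obtain ⟨x₀⟩ := (inferInstance : Nonempty M)
    exact ⟨f x₀, fun x => hloc.apply_eq_of_preconnectedSpace x x₀⟩
  · have : f = fun _ => c := funext hc
    rw [this, diff, mvfderiv_const]; rfl

lemma continuous_div {ξ : VField n M} (hξ : IsSmooth ξ) : Continuous (div ξ) := by
  refine continuous_iff_continuousAt.2 fun x => ?_
  obtain ⟨z, hz, hx⟩ := exists_par_eq n x
  rw [← hx]
  exact (mdifferentiableAt_of_comp_par hz (((contDiffOn_div_comp_par hξ x).contDiffAt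
    ((isOpen_dom n x).mem_nhds hz)).differentiableAt (by simp))).continuousAt

/-- On a compact manifold, a vector field with harmonic dual form has constant divergence. -/
theorem exists_div_eq_of_isHarmonic [ConnectedSpace M] [CompactSpace M] {ξ : VField n M}
    (hξ : IsSmooth ξ) (h : IsHarmonic (flat ξ)) : ∃ c, ∀ x, div ξ x = c := by
  set f : M → ℝ := codiffOne (flat ξ) with hf
  have hfd : f = fun x => -div ξ x := funext fun x => codiffOne_flat hξ x
  have hfc : Continuous f := hfd ▸ (continuous_div hξ).neg
  obtain ⟨x₀, -, hx₀⟩ := isCompact_univ.exists_isMaxOn Set.univ_nonempty hfc.continuousOn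
  have hmax : ∀ x, f x ≤ f x₀ := fun x => hx₀ (Set.mem_univ x)
  have hclosed : IsClosed {x | f x = f x₀} := isClosed_eq hfc continuous_const
  -- The strong maximum principle in a chart about each maximum point.
  have hopen : IsOpen {x | f x = f x₀} := by
    refine isOpen_iff_mem_nhds.2 fun x (hx : f x = f x₀) => ?_
    obtain ⟨z, hz, hxz⟩ := exists_par_eq n x
    have hG := isMetricOn_metricRep (n := n) x
    have ha : ContDiffOn ℝ ∞ (fun y => metricRep x y (rep x ξ y)) (dom n x) :=
      hG.contDiffOn.clm_apply (contDiffOn_rep hξ)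
    have hfs : ContDiffOn ℝ ∞ (f ∘ par n x) (dom n x) := by
      rw [hfd]; exact (contDiffOn_div_comp_par hξ x).neg
    have hev := hG.eventually_eq_of_isMax (contDiffOn_curlOp (isOpen_dom n x) ha)
      (fun y _ u v => by rw [inner_curlOp, inner_curlOp]; ring) hfs
      (fun y hy w => fderiv_codiffOne_of_isHarmonic hξ h hy w) (m := f x₀)
      (fun y _ => hmax _) hz (by rw [Function.comp, hxz, hx])
    have hmem := par_image_mem_nhds hz hev
    rw [hxz] at hmem
    filter_upwards [hmem] with y hy
    obtain ⟨t, ht, rfl⟩ := hy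
    exact ht
  have huniv := IsClopen.eq_univ ⟨hclosed, hopen⟩ ⟨x₀, rfl⟩
  refine ⟨-f x₀, fun x => ?_⟩
  have hx : f x = f x₀ := (Set.eq_univ_iff_forall.1 huniv) x
  rw [← hx, hfd, neg_neg]

end Operators

/-! ### Consequences of the soliton equation. -/

section Soliton

set_option linter.unusedSectionVars false

variable {n : ℕ} {M : Type*} [TopologicalSpace M] [ChartedSpace (EuclideanSpace ℝ (Fin n)) M]
  [IsManifold (𝓡 n) ∞ M] [Bundle.RiemannianBundle (fun x : M => TangentSpace (𝓡 n) x)]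
  [IsContMDiffRiemannianBundle (𝓡 n) ∞ (EuclideanSpace ℝ (Fin n))
      (fun x : M => TangentSpace (𝓡 n) x)]
  {p : M} {z : EuclideanSpace ℝ (Fin n)} {ξ : VField n M} {lam mu : ℝ}

local notation "𝔼" => EuclideanSpace ℝ (Fin n)

local notation "⟪" x ", " y "⟫" => inner ℝ x y

/-- The Lie derivative of the metric in coordinates. -/
lemma lieMetric_dpar (hz : z ∈ dom n p) (hξ : IsDiffAt ξ (par n p z)) (u v : 𝔼) :
    lieMetric ξ (par n p z) (dpar p z u) (dpar p z v) =
      ⟪fderiv ℝ (metricRep p) z (rep p ξ z) u, v⟫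
        + ⟪metricRep p z (fderiv ℝ (rep p ξ) z u), v⟫
        + ⟪metricRep p z u, fderiv ℝ (rep p ξ) z v⟫ := by
  have hX := fun w => mdifferentiableAt_ext (n := n) (dpar p z w)
  have h1 := diff_g_dpar hz (hX u) (hX v) (rep p ξ z)
  rw [dpar_rep hz, rep_ext hz, rep_ext hz] at h1
  rw [lieMetric, h1, bracket_eq_dpar hz hξ (hX u), bracket_eq_dpar hz hξ (hX v),
    ← inner_metricRep, ← inner_metricRep, rep_ext hz, rep_ext hz, map_sub, inner_sub_left,
    inner_sub_right]
  ring

/-- A property of tangent vectors may be checked in coordinates. -/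
lemma forall_of_forall_dpar {P : ∀ x : M, TangentSpace (𝓡 n) x → Prop}
    (h : ∀ (p : M), ∀ z ∈ dom n p, ∀ u : 𝔼, P (par n p z) (dpar p z u)) (x : M)
    (v : TangentSpace (𝓡 n) x) : P x v := by
  obtain ⟨z, hz, hx⟩ := exists_par_eq n x
  suffices ∀ y, par n x z = y → ∀ v : TangentSpace (𝓡 n) y, P y v from this x hx v
  rintro _ rfl v
  rw [← dpar_inverse_apply hz v]
  exact h x z hz _

/-- Linearity in w is hidden by the extensions in the definition. Once it is known here, the soliton
equation passes it on to the Ricci tensor, so tensoriality of the curvature never has to be proved.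
-/
lemma exists_lieMetric_eq_g (hξ : IsSmooth ξ) (x : M) (v : TangentSpace (𝓡 n) x) :
    ∃ q, ∀ w, lieMetric ξ x v w = g x q w := by
  refine forall_of_forall_dpar (P := fun x v => ∃ q, ∀ w, lieMetric ξ x v w = g x q w)
    (fun p z hz u => ?_) x v
  have hG := isMetricOn_metricRep (n := n) p
  refine ⟨dpar p z (invMetric (metricRep p) z (fderiv ℝ (metricRep p) z (rep p ξ z) u
    + metricRep p z (fderiv ℝ (rep p ξ) z u)
    + (fderiv ℝ (rep p ξ) z).adjoint (metricRep p z u))), fun w => ?_⟩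
  rw [← dpar_inverse_apply hz w, lieMetric_dpar hz (hξ.isDiffAt _), ← inner_metricRep,
    hG.apply_invMetric hz, inner_add_left, inner_add_left,
    ContinuousLinearMap.adjoint_inner_left]

/-- The diagonal suffices, since it is used to identify the trace of the Lie derivative with twice
the divergence. -/
lemma lieMetric_self (hξ : IsSmooth ξ) (x : M) (v : TangentSpace (𝓡 n) x) :
    lieMetric ξ x v v = 2 * g x (nabla (ext v) ξ x) v := by
  refine forall_of_forall_dpar
    (P := fun x v => lieMetric ξ x v v = 2 * g x (nabla (ext v) ξ x) v) (fun p z hz u => ?_) x v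
  have hG := isMetricOn_metricRep (n := n) p
  rw [lieMetric_dpar hz (hξ.isDiffAt _), nabla_dpar hz (mdifferentiableAt_ext _) (hξ.isDiffAt _),
    ← inner_metricRep, rep_ext hz, map_add, inner_add_left, hG.apply_gam hz,
    hG.fderiv_symm hz u u, hG.symm z hz u]
  ring

/-- The Ricci tensor of a soliton is linear in its second argument. -/
lemma IsEtaRicciSoliton.g_ricciOp (h : IsEtaRicciSoliton ξ (flat ξ) lam mu) (hξ : IsSmooth ξ)
    (x : M) (v w : TangentSpace (𝓡 n) x) : g x (ricciOp x v) w = ricci x v w := by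
  obtain ⟨q, hq⟩ := exists_lieMetric_eq_g hξ x v
  have key : ∀ w, ricci x v w =
      g x (-((1 / 2 : ℝ) • q + lam • v + (mu * g x (ξ x) v) • ξ x)) w := by
    intro w
    have h1 := h x v w
    rw [hq w] at h1
    have h2 : ∀ w, flat ξ x w = g x (ξ x) w := fun _ => rfl
    rw [h2, h2] at h1
    have h3 : g x (-((1 / 2 : ℝ) • q + lam • v + (mu * g x (ξ x) v) • ξ x)) w
        = -(1 / 2 * g x q w + lam * g x v w + mu * g x (ξ x) v * g x (ξ x) w) := by
      simp only [g, inner_neg_left, inner_add_left, inner_smul_left, conj_trivial]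
    rw [h3]
    linarith
  rw [ricciOp, dualVec_eq key, key]

lemma IsEtaRicciSoliton.ricciOp_eq_zero_iff (h : IsEtaRicciSoliton ξ (flat ξ) lam mu)
    (hξ : IsSmooth ξ) (x : M) (v : TangentSpace (𝓡 n) x) :
    ricciOp x v = 0 ↔ ∀ w, ricci x v w = 0 := by
  simp only [← h.g_ricciOp hξ]
  refine ⟨fun h w => by rw [h]; exact inner_zero_left w, fun h => ?_⟩
  exact ext_inner_right ℝ fun w => (h w).trans (inner_zero_left w).symm

/-- The trace of the soliton equation. -/
lemma IsEtaRicciSoliton.div_eq (h : IsEtaRicciSoliton ξ (flat ξ) lam mu) (hξ : IsSmooth ξ)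
    (x : M) : div ξ x = -(scal n x + mu * g x (ξ x) (ξ x)) - lam * n := by
  have h1 : ∀ i, g x (nabla (ext (onb x i)) ξ x) (onb x i)
      = -ricci x (onb x i) (onb x i) - lam * g x (onb x i) (onb x i)
        - mu * (g x (ξ x) (onb x i) * g x (onb x i) (ξ x)) := fun i => by
    have h2 := h x (onb x i) (onb x i)
    rw [lieMetric_self hξ] at h2
    rw [g_comm x (onb x i) (ξ x)]
    have h3 : flat ξ x (onb x i) = g x (ξ x) (onb x i) := rfl
    rw [h3] at h2
    linarith
  have h4 : ∀ i : Fin (Module.finrank ℝ (TangentSpace (𝓡 n) x)),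
      g x (onb x i) (onb x i) = 1 := fun i =>
    (real_inner_self_eq_norm_sq _).trans (by rw [(onb x).norm_eq_one, one_pow])
  have h5 : ∑ i : Fin (Module.finrank ℝ (TangentSpace (𝓡 n) x)),
      g x (ξ x) (onb x i) * g x (onb x i) (ξ x) = g x (ξ x) (ξ x) :=
    (onb x).sum_inner_mul_inner _ _
  have h6 : Module.finrank ℝ (TangentSpace (𝓡 n) x) = n := finrank_euclideanSpace_fin (𝕜 := ℝ)
  rw [div, tr]
  simp only [h1, h4, Finset.sum_sub_distrib, ← Finset.mul_sum, h5, Finset.sum_neg_distrib]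
  rw [scal, tr]
  simp only [Finset.sum_const, Finset.card_univ, Fintype.card_fin, h6, nsmul_eq_mul, mul_one]
  ring

/-- Smoothness of the scalar curvature is not required: the function on the left is affine in the
divergence by `div_eq`. -/
lemma IsEtaRicciSoliton.diff_scal_add (h : IsEtaRicciSoliton ξ (flat ξ) lam mu) (hξ : IsSmooth ξ)
    (x : M) (w : TangentSpace (𝓡 n) x) :
    diff (fun x : M => scal n x + mu * g x (ξ x) (ξ x)) x w = -diff (div ξ) x w := by
  refine forall_of_forall_dpar (P := fun x w =>
    diff (fun x : M => scal n x + mu * g x (ξ x) (ξ x)) x w = -diff (div ξ) x w)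
    (fun p z hz u => ?_) x w
  have h1 : (fun x : M => scal n x + mu * g x (ξ x) (ξ x)) ∘ par n p
      = fun y => -((div ξ ∘ par n p) y) - lam * n := by
    funext y
    simp only [Function.comp, h.div_eq hξ]
    ring
  rw [diff_dpar hz, diff_dpar hz, h1, fderiv_sub_const, fderiv_fun_neg]
  rfl

/-- The function `scal + mu |ξ|²` is constant exactly when the divergence of `ξ` is. -/
lemma IsEtaRicciSoliton.exists_scal_add_eq_iff [ConnectedSpace M]
    (h : IsEtaRicciSoliton ξ (flat ξ) lam mu) (hξ : IsSmooth ξ) :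
    (∃ c : ℝ, ∀ x : M, scal n x + mu * g x (ξ x) (ξ x) = c)
      ↔ ∀ x w, diff (n := n) (div ξ) x w = 0 := by
  rw [forall_diff_eq_zero_iff (contDiffOn_div_comp_par hξ)]
  exact ⟨fun ⟨c, hc⟩ => ⟨-c - lam * n, fun x => by rw [h.div_eq hξ, hc]⟩,
    fun ⟨c, hc⟩ => ⟨-c - lam * n, fun x => by rw [← hc x, h.div_eq hξ]; ring⟩⟩

end Soliton

end EtaRicci

/-! ### The equivalences. -/

theorem mainTheorem5 {n : ℕ} (hn : 2 < n)
    {M : Type*} [TopologicalSpace M] [T2Space M] [SecondCountableTopology M] [ConnectedSpace M]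
    [ChartedSpace (EuclideanSpace ℝ (Fin n)) M] [IsManifold (𝓡 n) ∞ M]
    [Bundle.RiemannianBundle (fun x : M => TangentSpace (𝓡 n) x)]
    [IsContMDiffRiemannianBundle (𝓡 n) ∞ (EuclideanSpace ℝ (Fin n))
      (fun x : M => TangentSpace (𝓡 n) x)]
    (ξ : EtaRicci.VField n M) (hξ : EtaRicci.IsSmooth ξ)
    (η : EtaRicci.OneForm n M) (hη : η = EtaRicci.flat ξ)
    (lam mu : ℝ) (hsol : EtaRicci.IsEtaRicciSoliton ξ η lam mu) :
    (EtaRicci.IsSRSolution η →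
      (EtaRicci.IsSRHarmonic η ↔
        ∃ c : ℝ, ∀ x : M, EtaRicci.scal n x + mu * EtaRicci.g x (ξ x) (ξ x) = c) ∧
      (EtaRicci.IsHarmonic η ↔
        EtaRicci.flat (fun x => EtaRicci.ricciOp x (ξ x)) =
          EtaRicci.diff (fun x : M => EtaRicci.scal n x + mu * EtaRicci.g x (ξ x) (ξ x))) ∧
      ((CompactSpace M ∨ ∀ x : M, EtaRicci.div ξ x = 0) →
        EtaRicci.IsHarmonic η → ∀ x : M, EtaRicci.ricciOp x (ξ x) = 0)) ∧
    (EtaRicci.IsSRHarmonic η →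
      (EtaRicci.IsSRSolution η ↔
        ∃ c : ℝ, ∀ x : M, EtaRicci.scal n x + mu * EtaRicci.g x (ξ x) (ξ x) = c) ∧
      (EtaRicci.IsHarmonic η ↔ ∀ x : M, EtaRicci.ricciOp x (ξ x) = 0)) ∧
    (EtaRicci.IsHarmonic η →
      ((CompactSpace M ∨ ∀ x : M, EtaRicci.div ξ x = 0) →
        (EtaRicci.IsSRSolution η ↔ ∀ x : M, EtaRicci.ricciOp x (ξ x) = 0)) ∧
      (EtaRicci.IsSRHarmonic η ↔ ∀ x : M, EtaRicci.ricciOp x (ξ x) = 0)) := by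
  subst hη
  have hconst := hsol.exists_scal_add_eq_iff hξ
  have hsharp : ∀ x w, EtaRicci.ricciSharp (EtaRicci.flat ξ) x w = EtaRicci.ricci x (ξ x) w :=
    fun x w => by rw [EtaRicci.ricciSharp, EtaRicci.sharp_flat]
  have hker : (∀ x : M, EtaRicci.ricciOp x (ξ x) = 0) ↔
      ∀ x w, EtaRicci.ricci x (ξ x) w = 0 :=
    forall_congr' fun x => hsol.ricciOp_eq_zero_iff hξ x (ξ x)
  have hflat : EtaRicci.flat (fun x => EtaRicci.ricciOp x (ξ x)) =
      EtaRicci.diff (fun x : M => EtaRicci.scal n x + mu * EtaRicci.g x (ξ x) (ξ x)) ↔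
      ∀ x w, EtaRicci.ricci x (ξ x) w + EtaRicci.diff (EtaRicci.div ξ) x w = 0 := by
    simp only [funext_iff, ContinuousLinearMap.ext_iff, hsol.diff_scal_add hξ]
    refine forall_congr' fun x => forall_congr' fun w => ?_
    rw [← hsol.g_ricciOp hξ]
    exact eq_neg_iff_add_eq_zero
  -- Only here does the alternative of compactness or zero divergence enter: a harmonic η then has
  -- constant div ξ.
  have hdiv : (CompactSpace M ∨ ∀ x : M, EtaRicci.div ξ x = 0) →
      EtaRicci.IsHarmonic (EtaRicci.flat ξ) → ∀ x w, EtaRicci.diff (EtaRicci.div ξ) x w = 0 :=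
    fun hM hh => (EtaRicci.forall_diff_eq_zero_iff (EtaRicci.contDiffOn_div_comp_par hξ)).2 <| by
      rcases hM with hM | hM
      · exact EtaRicci.exists_div_eq_of_isHarmonic hξ hh
      · exact ⟨0, hM⟩
  -- After this every condition is a pointwise linear equation in Δη, S(ξ, ·) and d(div ξ), so each
  -- implication is a linear combination.
  simp only [EtaRicci.IsSRSolution, EtaRicci.IsSRHarmonic, EtaRicci.sharp_flat, hsharp, hconst,
    hker, hflat]
  simp only [EtaRicci.IsHarmonic] at hdiv ⊢
  refine ⟨fun h => ⟨⟨fun h1 x w => ?_, fun h1 x w => ?_⟩, ⟨fun h1 x w => ?_, fun h1 x w => ?_⟩,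
      fun hM h1 x w => ?_⟩,
    fun h => ⟨⟨fun h1 x w => ?_, fun h1 x w => ?_⟩, ⟨fun h1 x w => ?_, fun h1 x w => ?_⟩⟩,
    fun h => ⟨fun hM => ⟨fun h1 x w => ?_, fun h1 x w => ?_⟩,
      ⟨fun h1 x w => ?_, fun h1 x w => ?_⟩⟩⟩
  · linarith [h x w, h1 x w]
  · linarith [h x w, h1 x w]
  · linarith [h x w, h1 x w]
  · linarith [h x w, h1 x w]
  · linarith [h x w, h1 x w, hdiv hM h1 x w]
  · linarith [h x w, h1 x w]
  · linarith [h x w, h1 x w]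
  · linarith [h x w, h1 x w]
  · linarith [h x w, h1 x w]
  · linarith [h x w, h1 x w, hdiv hM h x w]
  · linarith [h x w, h1 x w, hdiv hM h x w]
  · linarith [h x w, h1 x w]
  · linarith [h x w, h1 x w]
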